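/- Let $(\Sigma,g)$ be a closed smooth Riemannian manifold (compact, connected, without boundary) of dimension $d\ge 1$, for instance a closed surface, and let $\Delta_g$ be its Laplace--Beltrami operator and $\nabla$ its gradient. For each $1\le i\le n$ let $P_i\subset\Sigma$ be a (possibly empty) set consisting of isolated points (a discrete subset), and let $u_i$ be a real-valued $C^2$ function on $\Sigma\setminus P_i$ with $u_i(x)\to+\infty$ as $x\to p$, for every $p\in P_i$. Put $P=\bigcup_{i=1}^n P_i$. Let $c_{ij}$, $1\le i,j\le n$, be continuous and bounded functions on $\Sigma\setminus P$ such that, on $\Sigma\setminus P$, (a) $c_{ij}\ge 0$ for $i\ne j$ (cooperative); (b) $\sum_{i=1}^n c_{ij}\le 0$ for $1\le j\le n$ (column diagonally dominant); (c) the index set $\{1,\dots,n\}$ cannot be split up into two disjoint nonempty sets $\alpha,\beta$ such that $c_{ij}\equiv 0$ for all $i\in\alpha$, $j\in\beta$ (fully coupled). Let $f_1,\dots,f_n$ be non-positive continuous functions on $\Sigma\setminus P$ and let $X$ be a continuous vector field on $\Sigma$. Suppose that $$\Delta_g u_i+\langle X,\nabla u_i\rangle+\sum_{j=1}^n c_{ij}u_j=f_i\quad\text{in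 }\Sigma\setminus P,\qquad 1\le i\le n.$$ Then: (1) if there are $i_0\in\{1,\dots,n\}$ and $p_0\in\Sigma\setminus P$ with $f_{i_0}(p_0)\ne 0$, then $u_i>0$ on $\Sigma\setminus P_i$ for all $1\le i\le n$; (2) if $P$ is nonempty, then $u_i>0$ on $\Sigma\setminus P_i$ for all $1\le i\le n$; (3) if $\sum_{i=1}^n u_i\ge 0$ on $\Sigma\setminus P$, then either $u_i>0$ on $\Sigma\setminus P_i$ for all $1\le i\le n$, or $u_i\equiv 0$ on $\Sigma\setminus P_i$ for all $1\le i\le n$. -/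

import Mathlib

open Set Filter Topology Manifold Bundle
open scoped ContDiff

noncomputable section

/-- A smooth Riemannian metric on a smooth manifold modelled on `ℝ^d`. -/
abbrev SmoothMetric (d : ℕ) (M : Type*) [TopologicalSpace M]
    [ChartedSpace (EuclideanSpace ℝ (Fin d)) M] [IsManifold (𝓡 d) ∞ M] :=
  ContMDiffRiemannianMetric (𝓡 d) ∞ (EuclideanSpace ℝ (Fin d))
    (fun x : M => TangentSpace (𝓡 d) x)

/-- The `i`-th partial derivative of a function on `ℝ^d`. -/
def partialD {d : ℕ} (i : Fin d) (F : EuclideanSpace ℝ (Fin d) → ℝ)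
    (y : EuclideanSpace ℝ (Fin d)) : ℝ :=
  fderiv ℝ F y (EuclideanSpace.single i 1)

namespace SmoothMetric

variable {d : ℕ} {M : Type*} [TopologicalSpace M]
  [ChartedSpace (EuclideanSpace ℝ (Fin d)) M] [IsManifold (𝓡 d) ∞ M]

/-- The `i`-th coordinate vector field of the chart `e`, at the point with coordinates `y`. -/
def coordVec (e : OpenPartialHomeomorph M (EuclideanSpace ℝ (Fin d)))
    (y : EuclideanSpace ℝ (Fin d)) (i : Fin d) : TangentSpace (𝓡 d) (e.symm y) :=
  mfderiv (𝓡 d) (𝓡 d) e.symm y (EuclideanSpace.single i (1 : ℝ) : EuclideanSpace ℝ (Fin d))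

/-- The matrix `g_ij` of the metric in the chart `e`. -/
def coordMatrix (g : SmoothMetric d M) (e : OpenPartialHomeomorph M (EuclideanSpace ℝ (Fin d)))
    (y : EuclideanSpace ℝ (Fin d)) : Matrix (Fin d) (Fin d) ℝ :=
  Matrix.of fun i j => g.inner (e.symm y) (coordVec e y i) (coordVec e y j)

/-- The Christoffel symbol `Γ^k_ij` of the Levi-Civita connection in the chart `e`. -/
def christoffel (g : SmoothMetric d M) (e : OpenPartialHomeomorph M (EuclideanSpace ℝ (Fin d)))
    (k i j : Fin d) (y : EuclideanSpace ℝ (Fin d)) : ℝ :=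
  (1 / 2) * ∑ l, (coordMatrix g e y)⁻¹ k l *
    (partialD i (fun z => coordMatrix g e z j l) y + partialD j (fun z => coordMatrix g e z i l) y
      - partialD l (fun z => coordMatrix g e z i j) y)

/-- The Laplace-Beltrami operator, as the metric trace of the covariant Hessian, computed in the
chart `e`: `Δ_g u = g^ij (∂_i ∂_j u - Γ^k_ij ∂_k u)`. -/
def laplacianInChart (g : SmoothMetric d M)
    (e : OpenPartialHomeomorph M (EuclideanSpace ℝ (Fin d))) (u : M → ℝ) (x : M) : ℝ :=
  ∑ i, ∑ j, (coordMatrix g e (e x))⁻¹ i j *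
    (partialD i (partialD j (u ∘ e.symm)) (e x)
      - ∑ k, christoffel g e k i j (e x) * partialD k (u ∘ e.symm) (e x))

/-- The Laplace-Beltrami operator `Δ_g u` at `x` (for `u` of class `C²` near `x` the value does
not depend on the chart around `x`; we take the preferred one). -/
def laplacian (g : SmoothMetric d M) (u : M → ℝ) (x : M) : ℝ :=
  laplacianInChart g (chartAt (EuclideanSpace ℝ (Fin d)) x) u x

/-- The metric at `x` as a bilinear form on the tangent space. -/
def bilin (g : SmoothMetric d M) (x : M) : LinearMap.BilinForm ℝ (TangentSpace (𝓡 d) x) :=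
  LinearMap.mk₂ ℝ (fun v w => g.inner x v w) (by simp) (by simp) (by simp) (by simp)

theorem bilin_nondegenerate (g : SmoothMetric d M) (x : M) : (bilin g x).Nondegenerate := by
  constructor
  · intro v hv
    by_contra h
    exact (g.pos x v h).ne' (hv v)
  · intro v hv
    by_contra h
    exact (g.pos x v h).ne' (hv v)

instance instFiniteDimensionalTangent (x : M) : FiniteDimensional ℝ (TangentSpace (𝓡 d) x) :=
  inferInstanceAs (FiniteDimensional ℝ (EuclideanSpace ℝ (Fin d)))

/-- The Riemannian gradient: the vector `∇u` at `x` with `⟨∇u, v⟩ = du(v)` for all `v`. -/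
def gradient (g : SmoothMetric d M) (u : M → ℝ) (x : M) : TangentSpace (𝓡 d) x :=
  ((bilin g x).toDual (bilin_nondegenerate g x)).symm
    (mfderiv (𝓡 d) 𝓘(ℝ, ℝ) u x : TangentSpace (𝓡 d) x →L[ℝ] ℝ).toLinearMap

theorem inner_gradient (g : SmoothMetric d M) (u : M → ℝ) (x : M) (v : TangentSpace (𝓡 d) x) :
    g.inner x (gradient g u x) v = mfderiv (𝓡 d) 𝓘(ℝ, ℝ) u x v :=
  LinearMap.BilinForm.apply_toDual_symm_apply (B := bilin g x) (hB := bilin_nondegenerate g x) _ v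

end SmoothMetric

/-- The index set cannot be split into two disjoint nonempty sets `α`, `β` such that `c i j`
vanishes identically on `U` for all `i ∈ α`, `j ∈ β`. -/
def FullyCoupled {M : Type*} {n : ℕ} (c : Fin n → Fin n → M → ℝ) (U : Set M) : Prop :=
  ¬ ∃ α β : Set (Fin n), α.Nonempty ∧ β.Nonempty ∧ Disjoint α β ∧ α ∪ β = univ ∧
    ∀ i ∈ α, ∀ j ∈ β, ∀ x ∈ U, c i j x = 0

end

/-! Write `L = Δ_g + ⟨X, ∇·⟩`, and let `v_j` be `min (u_j, 0)`, set to `0` on the poles of `u_j`;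
since `u_j → +∞` there, `v_j` is continuous on all of `M`. Near a point `x`, the function `∑ v_j`
lies below the `C²` function `∑_{j ∈ S} u_j`, where `S` is the set of `j` with `u_j(x) < 0`, with
equality at `x`. Summing the equations over `S`, column dominance and cooperativity give `L (∑_{j ∈
S} u_j) ≤ 0` at `x`. So `∑ v_j` is a supersolution in the touching sense; it attains its minimum by
compactness, and the strong minimum principle makes it a constant `m ≤ 0`.

Leaving out one index `i` gives `m - v_i ≥ m`, again a supersolution up to a zeroth order term
bounded by a multiple of its excess `-v_i` over `m`. Hence each `v_i` vanishes identically or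
nowhere.

If `m < 0`, the indices with `v_i < 0` form a nonempty set `S` with `∑_{i ∈ S} u_i = m`, so all the
inequalities above are equalities. This gives `f_i = 0` for `i ∈ S` and `c_ij = 0` for `i ∉ S`, `j ∈
S`; full coupling makes `S` everything, so there are no poles, `f = 0` and `∑ u_i = m < 0`. If `m =
0`, every `u_i` is nonnegative, the scalar strong minimum principle makes each one positive or
identically zero, and full coupling forbids a mixture. The three claims are read off from
`IsCooperativeSystem.trichotomy`.

The analytic input is `strong_minimum_principle`, reduced to `IsTouchedSupersolution.eventually_eq`
in charts. `Δ_g` is defined through a chart that varies with the point, so this reduction needs its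
coordinate invariance, `matrixLaplacian_comp`. -/

noncomputable section

/-! ### Second order operators on `ℝ^d`: local minima and the Gaussian barrier. -/

section Euclidean

variable {d : ℕ}

local notation "𝔼" d => EuclideanSpace ℝ (Fin d)

/-- The second order operator `φ ↦ a^ij ∂_i ∂_j φ + Dφ(b)` on `ℝ^d`. -/
def ellipticOp (a : (𝔼 d) → Matrix (Fin d) (Fin d) ℝ) (b : (𝔼 d) → 𝔼 d) (φ : (𝔼 d) → ℝ)
    (y : 𝔼 d) : ℝ :=
  ∑ i, ∑ j, a y i j * partialD i (partialD j φ) y + fderiv ℝ φ y (b y)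

theorem ContDiffAt.eventually_differentiableAt {E F : Type*} [NormedAddCommGroup E]
    [NormedSpace ℝ E] [NormedAddCommGroup F] [NormedSpace ℝ F] {φ : E → F} {y : E}
    (h : ContDiffAt ℝ 2 φ y) : ∀ᶠ z in 𝓝 y, DifferentiableAt ℝ φ z := by
  filter_upwards [h.eventually (by simp)] with z hz
  exact hz.differentiableAt (by simp)

theorem ContDiffAt.differentiableAt_fderiv_of_two {E F : Type*} [NormedAddCommGroup E]
    [NormedSpace ℝ E] [NormedAddCommGroup F] [NormedSpace ℝ F] {φ : E → F} {y : E}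
    (h : ContDiffAt ℝ 2 φ y) : DifferentiableAt ℝ (fderiv ℝ φ) y :=
  (h.fderiv_right (m := 1) (by norm_num)).differentiableAt (by simp)

theorem partialD_partialD {φ : (𝔼 d) → ℝ} {y : 𝔼 d} (h : ContDiffAt ℝ 2 φ y) (i j : Fin d) :
    partialD i (partialD j φ) y =
      fderiv ℝ (fderiv ℝ φ) y (EuclideanSpace.single i 1) (EuclideanSpace.single j 1) := by
  unfold partialD
  rw [fderiv_clm_apply h.differentiableAt_fderiv_of_two (by fun_prop)]
  simp

theorem partialD_congr {φ ψ : (𝔼 d) → ℝ} {y : 𝔼 d} (h : φ =ᶠ[𝓝 y] ψ) (i : Fin d) :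
    partialD i φ =ᶠ[𝓝 y] partialD i ψ := by
  filter_upwards [h.fderiv (𝕜 := ℝ)] with z hz
  simp [partialD, hz]

theorem ellipticOp_sub_smul {a : (𝔼 d) → Matrix (Fin d) (Fin d) ℝ} {b : (𝔼 d) → 𝔼 d}
    {φ ψ : (𝔼 d) → ℝ} {y : 𝔼 d} (hφ : ContDiffAt ℝ 2 φ y) (hψ : ContDiffAt ℝ 2 ψ y) (ε : ℝ) :
    ellipticOp a b (fun z => φ z - ε * ψ z) y = ellipticOp a b φ y - ε * ellipticOp a b ψ y := by
  have h1 : ∀ i, partialD i (fun z => φ z - ε * ψ z)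
      =ᶠ[𝓝 y] fun z => partialD i φ z - ε * partialD i ψ z := by
    intro i
    filter_upwards [hφ.eventually_differentiableAt, hψ.eventually_differentiableAt] with z h1 h2
    simp only [partialD]
    rw [fderiv_fun_sub h1 (h2.const_mul ε), fderiv_const_mul h2]
    simp
  have hd : ∀ {χ : (𝔼 d) → ℝ} (_ : ContDiffAt ℝ 2 χ y) (j : Fin d),
      DifferentiableAt ℝ (partialD j χ) y := by
    intro χ hχ j
    unfold partialD
    exact hχ.differentiableAt_fderiv_of_two.clm_apply (by fun_prop)
  have h2 : ∀ i j, partialD i (partialD j (fun z => φ z - ε * ψ z)) y =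
      partialD i (partialD j φ) y - ε * partialD i (partialD j ψ) y := by
    intro i j
    rw [(partialD_congr (h1 j) i).eq_of_nhds]
    rw [partialD, fderiv_fun_sub (hd hφ j) ((hd hψ j).const_mul ε), fderiv_const_mul (hd hψ j)]
    simp [partialD]
  unfold ellipticOp
  rw [fderiv_fun_sub (hφ.differentiableAt (by simp))
    ((hψ.differentiableAt (by simp)).const_mul ε),
    fderiv_const_mul (hψ.differentiableAt (by simp))]
  simp only [h2, mul_add, Finset.mul_sum, mul_sub, Finset.sum_sub_distrib]
  simp only [sub_apply, smul_apply, smul_eq_mul]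
  have : ∀ i j, a y i j * (ε * partialD i (partialD j ψ) y) =
    ε * (a y i j * partialD i (partialD j ψ) y) := fun i j => by ring
  simp only [this]
  ring

/-- Restrict to the line through `x` in direction `v`. A negative second derivative would make `0` a
local maximum as well as a local minimum, so the restriction would be locally constant and its
second derivative zero. -/
theorem fderiv_fderiv_nonneg_of_isLocalMin {ψ : (𝔼 d) → ℝ} {x : 𝔼 d}
    (hψ : ContDiffAt ℝ 2 ψ x) (hmin : IsLocalMin ψ x) (v : 𝔼 d) :
    0 ≤ fderiv ℝ (fderiv ℝ ψ) x v v := by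
  by_contra! hneg
  have hline : ContinuousAt (fun t : ℝ => x + t • v) 0 := by fun_prop
  have hl0 : (fun t : ℝ => x + t • v) 0 = x := by simp
  have htend : Tendsto (fun t : ℝ => x + t • v) (𝓝 0) (𝓝 x) := by simpa [ContinuousAt] using hline
  have hder : ∀ t : ℝ, HasDerivAt (fun t : ℝ => x + t • v) v t := fun t => by
    simpa using ((hasDerivAt_id t).smul_const v).const_add x
  set f : ℝ → ℝ := fun t => ψ (x + t • v) with hf
  have hf' : deriv f =ᶠ[𝓝 0] fun t => fderiv ℝ ψ (x + t • v) v := by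
    filter_upwards [htend.eventually hψ.eventually_differentiableAt] with t ht
    exact (ht.hasFDerivAt.comp_hasDerivAt t (hder t)).deriv
  have hf'' : deriv (deriv f) 0 = fderiv ℝ (fderiv ℝ ψ) x v v := by
    rw [hf'.deriv_eq]
    have h1 : HasFDerivAt (fderiv ℝ ψ) (fderiv ℝ (fderiv ℝ ψ) x) (x + (0 : ℝ) • v) := by
      simpa using hψ.differentiableAt_fderiv_of_two.hasFDerivAt
    have h2 := h1.comp_hasDerivAt (0 : ℝ) (hder 0)
    have h3 := h2.clm_apply (hasDerivAt_const (0 : ℝ) v)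
    simpa using h3.deriv
  have hmin' : IsLocalMin f 0 := by
    have := htend.eventually hmin
    filter_upwards [this] with t ht
    simpa [hf] using ht
  have hmax : IsLocalMax f 0 := by
    apply isLocalMax_of_deriv_deriv_neg (by rw [hf'']; exact hneg) hmin'.deriv_eq_zero
    have : ContinuousAt ψ ((fun t : ℝ => x + t • v) 0) := by rw [hl0]; exact hψ.continuousAt
    exact ContinuousAt.comp this hline
  have hconst : f =ᶠ[𝓝 0] fun _ => f 0 := by
    filter_upwards [hmin', hmax] with t h1 h2
    exact le_antisymm h2 h1
  have h4 : deriv f =ᶠ[𝓝 0] fun _ => 0 := by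
    filter_upwards [hconst.deriv] with t ht
    simpa using ht
  have h5 : deriv (deriv f) 0 = 0 := by rw [h4.deriv_eq]; simp
  rw [hf''] at h5
  exact hneg.ne h5

-- The gradient vanishes at the minimum. Factoring the coefficient matrix as `Bᵀ B` turns the second
-- order part into a sum of pure second derivatives along the rows of `B`.
open scoped MatrixOrder in
theorem ellipticOp_nonneg_of_isLocalMin {a : (𝔼 d) → Matrix (Fin d) (Fin d) ℝ} {b : (𝔼 d) → 𝔼 d}
    {ψ : (𝔼 d) → ℝ} {x : 𝔼 d} (ha : (a x).PosSemidef)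
    (hψ : ContDiffAt ℝ 2 ψ x) (hmin : IsLocalMin ψ x) : 0 ≤ ellipticOp a b ψ x := by
  unfold ellipticOp
  rw [hmin.fderiv_eq_zero]
  simp only [zero_apply, add_zero]
  obtain ⟨B, hB⟩ : ∃ B : Matrix (Fin d) (Fin d) ℝ, a x = B.conjTranspose * B :=
    CStarAlgebra.nonneg_iff_eq_star_mul_self.1 ha.nonneg
  have : ∑ i, ∑ j, a x i j * partialD i (partialD j ψ) x =
      ∑ k, fderiv ℝ (fderiv ℝ ψ) x (∑ i, B k i • EuclideanSpace.single i (1 : ℝ))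
        (∑ i, B k i • EuclideanSpace.single i (1 : ℝ)) := by
    simp only [map_sum, map_smul, sum_apply, smul_apply,
      smul_eq_mul, partialD_partialD hψ, hB, Matrix.mul_apply, Matrix.conjTranspose_apply,
      star_trivial, Finset.sum_mul, Finset.mul_sum]
    rw [Finset.sum_comm' (t' := Finset.univ) (s' := fun _ => Finset.univ) (by simp)]
    conv_rhs => rw [Finset.sum_comm]
    refine Finset.sum_congr rfl fun j _ => ?_
    rw [Finset.sum_comm]
    refine Finset.sum_congr rfl fun k _ => Finset.sum_congr rfl fun i _ => by ring
  rw [this]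
  exact Finset.sum_nonneg fun k _ => fderiv_fderiv_nonneg_of_isLocalMin hψ hmin _

/-- The Gaussian barrier. -/
def gaussianBarrier (α : ℝ) (c : 𝔼 d) (y : 𝔼 d) : ℝ := Real.exp (-α * ‖y - c‖ ^ 2)

theorem contDiff_gaussianBarrier (α : ℝ) (c : 𝔼 d) :
    ContDiff ℝ 2 (gaussianBarrier α c) := by
  unfold gaussianBarrier
  have : ContDiff ℝ 2 (fun y : 𝔼 d => ‖y - c‖ ^ 2) := (contDiff_id.sub contDiff_const).norm_sq ℝ
  fun_prop

theorem fderiv_gaussianBarrier (α : ℝ) (c y v : 𝔼 d) :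
    fderiv ℝ (gaussianBarrier α c) y v =
      -2 * α * inner ℝ (y - c) v * gaussianBarrier α c y := by
  have h1 : HasFDerivAt (fun y : 𝔼 d => ‖y - c‖ ^ 2) (2 • innerSL ℝ (y - c)) y := by
    simpa using ((hasFDerivAt_id y).sub_const c).norm_sq
  have h2 := (h1.const_mul (-α)).exp
  unfold gaussianBarrier
  rw [h2.fderiv]
  simp only [smul_apply, smul_eq_mul, nsmul_eq_mul, innerSL_apply_apply]
  push_cast
  ring

theorem ellipticOp_gaussianBarrier (a : (𝔼 d) → Matrix (Fin d) (Fin d) ℝ) (b : (𝔼 d) → 𝔼 d)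
    (α : ℝ) (c y : 𝔼 d) :
    ellipticOp a b (gaussianBarrier α c) y = gaussianBarrier α c y *
      (4 * α ^ 2 * (∑ i, ∑ j, a y i j * ((y - c) i * (y - c) j))
        - 2 * α * (∑ i, a y i i + inner ℝ (y - c) (b y))) := by
  have h1 : ∀ j : Fin d, partialD j (gaussianBarrier α c) =
      fun y => -2 * α * (y - c) j * gaussianBarrier α c y := by
    intro j
    funext z
    rw [partialD, fderiv_gaussianBarrier]
    simp [EuclideanSpace.inner_single_right]
  have h2 : ∀ i j : Fin d, partialD i (partialD j (gaussianBarrier α c)) y =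
      (4 * α ^ 2 * ((y - c) i * (y - c) j) - 2 * α * (if i = j then 1 else 0)) *
        gaussianBarrier α c y := by
    intro i j
    rw [h1 j]
    have hp : HasFDerivAt (fun y : 𝔼 d => (y - c) j) (EuclideanSpace.proj (𝕜 := ℝ) j) y := by
      have := (EuclideanSpace.proj (𝕜 := ℝ) j : (𝔼 d) →L[ℝ] ℝ).hasFDerivAt (x := y)
      simpa using this.sub_const (c j)
    have hg : HasFDerivAt (gaussianBarrier α c) (fderiv ℝ (gaussianBarrier α c) y) y :=
      ((contDiff_gaussianBarrier α c).differentiable (by simp) y).hasFDerivAt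
    have := ((hp.const_mul (-2 * α)).mul hg).fderiv
    rw [partialD]
    erw [this]
    simp only [add_apply, smul_apply, smul_eq_mul,
      fderiv_gaussianBarrier, EuclideanSpace.inner_single_right]
    simp only [PiLp.proj_apply, PiLp.single_apply, eq_comm (a := j) (b := i)]
    split_ifs <;> simp <;> ring
  unfold ellipticOp
  simp only [h2, fderiv_gaussianBarrier, Finset.mul_sum, mul_sub, mul_add]
  have h3 : ∀ i j : Fin d, a y i j * ((4 * α ^ 2 * ((y - c) i * (y - c) j)
        - 2 * α * (if i = j then 1 else 0)) * gaussianBarrier α c y) =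
      gaussianBarrier α c y * (4 * α ^ 2 * (a y i j * ((y - c) i * (y - c) j))) -
      (if i = j then gaussianBarrier α c y * (2 * α * a y i j) else 0) := by
    intro i j
    split_ifs <;> ring
  simp only [h3, Finset.sum_sub_distrib, Finset.sum_ite_eq, Finset.mem_univ, if_true]
  ring

end Euclidean
end

noncomputable section

/-! ### The local strong minimum principle. -/

section Euclidean

variable {d : ℕ}

local notation "𝔼" d => EuclideanSpace ℝ (Fin d)

theorem sum_mul_pos_of_posDef {A : Matrix (Fin d) (Fin d) ℝ} (hA : A.PosDef) {z : 𝔼 d}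
    (hz : z ≠ 0) : 0 < ∑ i, ∑ j, A i j * (z i * z j) := by
  have hz' : (fun i => z i) ≠ 0 := fun h => hz (by ext i; exact congrFun h i)
  have := hA.dotProduct_mulVec_pos hz'
  simp only [dotProduct, Matrix.mulVec, Finset.mul_sum, Pi.star_apply, star_trivial] at this
  refine this.trans_eq (Finset.sum_congr rfl fun i _ => Finset.sum_congr rfl fun j _ => by ring)

/-- On a compact set avoiding the centre, the Gaussian barrier with a large parameter is a strict
subsolution. -/
theorem exists_gaussianBarrier_strict_subsolution {a : (𝔼 d) → Matrix (Fin d) (Fin d) ℝ}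
    {b : (𝔼 d) → 𝔼 d} {K : Set (𝔼 d)} (hK : IsCompact K) (ha : ContinuousOn a K)
    (hb : ContinuousOn b K) (hpos : ∀ x ∈ K, (a x).PosDef) {c : 𝔼 d} (hc : c ∉ K) (C : ℝ)
    (hC : 0 ≤ C) :
    ∃ α : ℝ, 0 < α ∧ ∀ x ∈ K,
      C * gaussianBarrier α c x < ellipticOp a b (gaussianBarrier α c) x := by
  have hx : ∀ i : Fin d, ContinuousOn (fun x : 𝔼 d => (x - c) i) K := fun i => by
    apply Continuous.continuousOn
    simp only [PiLp.sub_apply]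
    fun_prop
  have haij : ∀ i j, ContinuousOn (fun x => a x i j) K := fun i j =>
    (continuous_id.matrix_elem i j).comp_continuousOn ha
  obtain ⟨l, hl0, hl⟩ : ∃ l : ℝ, 0 < l ∧
      ∀ x ∈ K, l ≤ ∑ i, ∑ j, a x i j * ((x - c) i * (x - c) j) := by
    rcases K.eq_empty_or_nonempty with rfl | hne
    · exact ⟨1, one_pos, by simp⟩
    have hcont : ContinuousOn (fun x => ∑ i, ∑ j, a x i j * ((x - c) i * (x - c) j)) K :=
      continuousOn_finsetSum _ fun i _ => continuousOn_finsetSum _ fun j _ =>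
        (haij i j).mul ((hx i).mul (hx j))
    obtain ⟨x0, hx0, hmin⟩ := hK.exists_isMinOn hne hcont
    refine ⟨_, sum_mul_pos_of_posDef (hpos x0 hx0) (sub_ne_zero.2 ?_), fun x hx => hmin hx⟩
    rintro rfl
    exact hc hx0
  obtain ⟨N, hN⟩ : ∃ N : ℝ, ∀ x ∈ K, ‖∑ i, a x i i + inner ℝ (x - c) (b x)‖ ≤ N := by
    apply hK.exists_bound_of_continuousOn
    refine (continuousOn_finsetSum _ fun i _ => haij i i).add ?_
    exact ContinuousOn.inner (𝕜 := ℝ) (by fun_prop) hb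
  set k := max N 0
  have hk0 : 0 ≤ k := le_max_right _ _
  -- With `l` a lower bound for the quadratic form and `k` an upper bound for the first order
  -- factor, the goal is `4 α² l - 2 α k > C`. It follows from `4 l α ≥ 2 k + C + 1` together with
  -- `α ≥ 1`.
  set α := max 1 ((2 * k + C + 1) / (4 * l)) with hα
  have hα1 : 1 ≤ α := le_max_left _ _
  have hα2 : 2 * k + C + 1 ≤ 4 * l * α := by
    have := le_max_right 1 ((2 * k + C + 1) / (4 * l))
    rw [← hα, div_le_iff₀ (by positivity)] at this
    linarith
  refine ⟨α, by linarith, fun x hx => ?_⟩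
  rw [ellipticOp_gaussianBarrier, mul_comm]
  have hg : 0 < gaussianBarrier α c x := Real.exp_pos _
  apply mul_lt_mul_of_pos_left _ hg
  have h1 := hl x hx
  have h2 : ∑ i, a x i i + inner ℝ (x - c) (b x) ≤ k :=
    (le_abs_self _).trans ((hN x hx).trans (le_max_left _ _))
  have h3 : 4 * α ^ 2 * l ≤ 4 * α ^ 2 * ∑ i, ∑ j, a x i j * ((x - c) i * (x - c) j) :=
    mul_le_mul_of_nonneg_left h1 (by positivity)
  have h4 : 2 * α * (∑ i, a x i i + inner ℝ (x - c) (b x)) ≤ 2 * α * k :=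
    mul_le_mul_of_nonneg_left h2 (by positivity)
  nlinarith

/-- `w` is, at every point of `U`, touched from above by a `C²` function `φ` with
`Lφ ≤ C (w - m)` there. -/
def IsTouchedSupersolution (a : (𝔼 d) → Matrix (Fin d) (Fin d) ℝ) (b : (𝔼 d) → 𝔼 d)
    (C m : ℝ) (w : (𝔼 d) → ℝ) (U : Set (𝔼 d)) : Prop :=
  ∀ x ∈ U, ∃ φ : (𝔼 d) → ℝ, ContDiffAt ℝ 2 φ x ∧ φ x = w x ∧ (∀ᶠ y in 𝓝 x, w y ≤ φ y) ∧
    ellipticOp a b φ x ≤ C * (w x - m)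

/-- A supersolution cannot attain its minimum at a point of the boundary of a ball on which it is
otherwise larger than the minimum, if this point is interior to the domain. -/
theorem IsTouchedSupersolution.false_of_touching_ball {a : (𝔼 d) → Matrix (Fin d) (Fin d) ℝ}
    {b : (𝔼 d) → 𝔼 d} {C m : ℝ} (hC : 0 ≤ C) {w : (𝔼 d) → ℝ} {U : Set (𝔼 d)}
    (hw : IsTouchedSupersolution a b C m w U) (ha : ContinuousOn a U)
    (hb : ContinuousOn b U) (hpos : ∀ x ∈ U, (a x).PosDef) (hwc : ContinuousOn w U)
    (hm : ∀ x ∈ U, m ≤ w x) {c y : 𝔼 d} {δ : ℝ} (hδ0 : 0 < δ) (hδ : δ < dist y c)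
    (hU : Metric.closedBall y δ ⊆ U) (hy : w y = m)
    (hlt : ∀ z ∈ Metric.closedBall y δ, z ≠ y → dist z c ≤ dist y c → m < w z) : False := by
  set K := Metric.closedBall y δ
  have hKc : IsCompact K := isCompact_closedBall y δ
  have hcK : c ∉ K := by
    simp only [K, Metric.mem_closedBall, not_le, dist_comm c y]
    exact hδ
  obtain ⟨α, hα, hsub⟩ := exists_gaussianBarrier_strict_subsolution hKc (ha.mono hU) (hb.mono hU)
    (fun x hx => hpos x (hU hx)) hcK C hC
  set h0 := gaussianBarrier α c y
  have hgc : Continuous (gaussianBarrier α c) := (contDiff_gaussianBarrier α c).continuous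
  have hfar : ∀ z, dist y c < dist z c → gaussianBarrier α c z < h0 := by
    intro z hz
    simp only [h0, gaussianBarrier, ← dist_eq_norm]
    apply Real.exp_lt_exp.2
    have : dist y c ^ 2 < dist z c ^ 2 := by gcongr
    nlinarith
  -- On the part of the sphere around `y` lying in the ball around `c`, `w` exceeds `m` by a uniform
  -- amount, by compactness; on the rest the barrier is below its value at `y`.
  obtain ⟨μ, hμ0, hμ⟩ : ∃ μ : ℝ, 0 < μ ∧
      ∀ z ∈ Metric.sphere y δ, dist z c ≤ dist y c → m + μ ≤ w z := by
    set T := Metric.sphere y δ ∩ {z | dist z c ≤ dist y c}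
    have hTK : T ⊆ K := fun z hz => Metric.sphere_subset_closedBall hz.1
    rcases T.eq_empty_or_nonempty with hT | hT
    · refine ⟨1, one_pos, fun z h1 h2 => ?_⟩
      have : z ∈ T := ⟨h1, h2⟩
      simp [hT] at this
    · have hTc : IsCompact T := (isCompact_sphere y δ).inter_right
        (isClosed_le (by fun_prop) (by fun_prop))
      obtain ⟨z0, hz0, hmin⟩ := hTc.exists_isMinOn hT (hwc.mono (hTK.trans hU))
      have hz0y : z0 ≠ y := by
        rintro rfl
        have := hz0.1
        simp at this
        linarith
      refine ⟨w z0 - m, sub_pos.2 (hlt z0 (hTK hz0) hz0y hz0.2), fun z h1 h2 => ?_⟩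
      have : w z0 ≤ w z := hmin ⟨h1, h2⟩
      linarith
  -- As the barrier has values in `(0, 1]`, this `ε` costs less than `μ`. Hence `w - ε h`, with `h`
  -- the barrier, is larger on the sphere than at `y`, and its minimum over the closed ball is
  -- interior.
  set ε := μ / 2 with hε
  have hε0 : 0 < ε := by positivity
  have hg1 : ∀ z, gaussianBarrier α c z ≤ 1 := fun z => by
    rw [gaussianBarrier, Real.exp_le_one_iff]
    nlinarith [sq_nonneg ‖z - c‖]
  have hg0 : ∀ z, 0 < gaussianBarrier α c z := fun z => Real.exp_pos _
  set F : (𝔼 d) → ℝ := fun z => w z - ε * gaussianBarrier α c z with hF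
  have hFc : ContinuousOn F K := (hwc.mono hU).sub (continuousOn_const.mul hgc.continuousOn)
  obtain ⟨x, hxK, hxmin⟩ := hKc.exists_isMinOn ⟨y, Metric.mem_closedBall_self hδ0.le⟩ hFc
  have hxy : F x ≤ F y := hxmin (Metric.mem_closedBall_self hδ0.le)
  have hsph : ∀ z ∈ Metric.sphere y δ, F y < F z := by
    intro z hz
    simp only [hF, hy]
    by_cases hzc : dist z c ≤ dist y c
    · have h1 := hμ z hz hzc
      nlinarith [hg0 y, hg1 z]
    · have h1 := hm z (hU (Metric.sphere_subset_closedBall hz))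
      have h2 := hfar z (not_le.1 hzc)
      nlinarith
  have hxball : x ∈ Metric.ball y δ := by
    rcases (Metric.mem_closedBall.1 hxK).lt_or_eq with h | h
    · exact h
    · exact absurd (hsph x h) (not_lt.2 hxy)
  obtain ⟨φ, hφ, hφx, hφw, hLφ⟩ := hw x (hU hxK)
  have hgx : ContDiffAt ℝ 2 (gaussianBarrier α c) x := (contDiff_gaussianBarrier α c).contDiffAt
  have hloc : IsLocalMin (fun z => φ z - ε * gaussianBarrier α c z) x := by
    filter_upwards [hφw, Metric.isOpen_ball.mem_nhds hxball] with z hz hzb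
    have := hxmin (Metric.ball_subset_closedBall hzb)
    simp only [hF, mem_ofPred_eq] at this
    rw [hφx]
    linarith
  have hnn := ellipticOp_nonneg_of_isLocalMin (b := b) (hpos x (hU hxK)).posSemidef
    (hφ.sub (contDiffAt_const.mul hgx)) hloc
  rw [ellipticOp_sub_smul hφ hgx] at hnn
  have hs := hsub x hxK
  -- At the interior minimum, `Lφ ≥ ε Lh > C ε h`. Comparison with the value at `y` bounds `Lφ ≤ C
  -- (w - m)` by `C ε h`, a contradiction.
  have h5 : w x - m ≤ ε * gaussianBarrier α c x := by
    simp only [hF, hy] at hxy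
    nlinarith [hg0 y]
  have h6 : C * (w x - m) ≤ C * (ε * gaussianBarrier α c x) := mul_le_mul_of_nonneg_left h5 hC
  nlinarith

/-- The ball with diameter `[y₁, y]` is internally tangent at `y` to the ball around `y₁` through
`y`. Equality in the triangle inequality would make the centre also the midpoint of `y₁` and `z`,
forcing `z = y`. -/
theorem dist_lt_of_dist_midpoint_le {y₁ y z : 𝔼 d} (hz : z ≠ y)
    (h : dist z (midpoint ℝ y₁ y) ≤ dist y (midpoint ℝ y₁ y)) : dist z y₁ < dist y y₁ := by
  have hR : dist y (midpoint ℝ y₁ y) = dist y y₁ / 2 := by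
    rw [dist_right_midpoint, dist_comm y₁ y]; simp; ring
  have hR' : dist (midpoint ℝ y₁ y) y₁ = dist y y₁ / 2 := by
    rw [dist_midpoint_left, dist_comm y₁ y]; simp; ring
  rcases ((dist_triangle z (midpoint ℝ y₁ y) y₁).trans
    (by rw [hR']; rw [hR] at h; linarith : _ ≤ dist y y₁)).lt_or_eq with h1 | h1
  · exact h1
  · exfalso
    have h2 : dist z (midpoint ℝ y₁ y) = dist y y₁ / 2 := by
      have := dist_triangle z (midpoint ℝ y₁ y) y₁
      rw [hR] at h
      linarith
    have h3 : dist y₁ (midpoint ℝ y₁ y) = dist y₁ z / 2 := by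
      rw [dist_comm, hR', dist_comm y₁ z, h1]
    have h4 : midpoint ℝ y₁ y = midpoint ℝ y₁ z := by
      apply eq_midpoint_of_dist_eq_half h3
      rw [dist_comm _ z, h2, dist_comm y₁ z, h1]
    apply hz
    have := congrArg (fun p => p + p) h4
    simp only [midpoint_add_self] at this
    exact (add_left_cancel this).symm

/-- Strong minimum principle, local form: the set where a supersolution attains its minimum is
open. -/
theorem IsTouchedSupersolution.eventually_eq {a : (𝔼 d) → Matrix (Fin d) (Fin d) ℝ}
    {b : (𝔼 d) → 𝔼 d} {C m : ℝ} (hC : 0 ≤ C) {w : (𝔼 d) → ℝ} {U : Set (𝔼 d)} (hUo : IsOpen U)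
    (hw : IsTouchedSupersolution a b C m w U) (ha : ContinuousOn a U)
    (hb : ContinuousOn b U) (hpos : ∀ x ∈ U, (a x).PosDef) (hwc : ContinuousOn w U)
    (hm : ∀ x ∈ U, m ≤ w x) {y₀ : 𝔼 d} (hy₀ : y₀ ∈ U) (hwy : w y₀ = m) :
    ∀ᶠ y in 𝓝 y₀, w y = m := by
  obtain ⟨r, hr, hrU⟩ := Metric.nhds_basis_closedBall.mem_iff.1 (hUo.mem_nhds hy₀)
  filter_upwards [Metric.ball_mem_nhds y₀ (by positivity : 0 < r / 4)] with y₁ hy₁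
  by_contra hne
  rw [Metric.mem_ball] at hy₁
  set Z := Metric.closedBall y₀ r ∩ w ⁻¹' {m}
  have hZc : IsCompact Z := (isCompact_closedBall y₀ r).of_isClosed_subset
    ((hwc.mono hrU).preimage_isClosed_of_isClosed Metric.isClosed_closedBall isClosed_singleton)
    inter_subset_left
  have hy₀Z : y₀ ∈ Z := ⟨Metric.mem_closedBall_self hr.le, hwy⟩
  -- A point of the minimum set nearest to `y₁` need not be the only one, so the touching ball is
  -- centred at the midpoint of `y₁` and `y`; it meets the minimum set in `y` alone. Taking `y₁`
  -- within `r / 4` of `y₀` keeps a small closed ball around `y` inside the domain.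
  obtain ⟨y, hyZ, hmin⟩ := hZc.exists_isMinOn ⟨y₀, hy₀Z⟩
    (f := fun z => dist z y₁) (by fun_prop)
  have hyy : dist y y₁ ≤ dist y₀ y₁ := hmin hy₀Z
  rw [dist_comm y₀] at hyy
  have hyne : y ≠ y₁ := by
    rintro rfl
    exact hne hyZ.2
  have hpos' : 0 < dist y y₁ := dist_pos.2 hyne
  have hR : dist y (midpoint ℝ y₁ y) = dist y y₁ / 2 := by
    rw [dist_right_midpoint, dist_comm y₁ y]; simp; ring
  have hball : Metric.closedBall y (dist y y₁ / 4) ⊆ Metric.closedBall y₀ r := by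
    apply Metric.closedBall_subset_closedBall'
    have := dist_triangle y y₁ y₀
    linarith
  refine hw.false_of_touching_ball hC ha hb hpos hwc hm (c := midpoint ℝ y₁ y) (y := y)
    (δ := dist y y₁ / 4) (by positivity) (by rw [hR]; linarith) (hball.trans hrU) hyZ.2 ?_
  intro z hz hzy hzc
  refine lt_of_le_of_ne (hm z (hrU (hball hz))) fun heq => ?_
  have h1 : dist y y₁ ≤ dist z y₁ := hmin (⟨hball hz, heq.symm⟩ : z ∈ Z)
  exact absurd (dist_lt_of_dist_midpoint_le hzy hzc) (not_lt.2 h1)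

end Euclidean
end

noncomputable section
-- First and second derivatives under a change of coordinates.
section CoordinateChange

variable {E : Type*} [NormedAddCommGroup E] [NormedSpace ℝ E]

/-- The bilinear form `B(v, w) - Γ(v, w; n)`, where `Γ` is the Christoffel symbol of the first
kind built from the derivative `T` of a metric. -/
def koszulForm (B : E →L[ℝ] E →L[ℝ] ℝ) (T : E →L[ℝ] E →L[ℝ] E →L[ℝ] ℝ) (n : E) :
    E →ₗ[ℝ] E →ₗ[ℝ] ℝ :=
  LinearMap.mk₂ ℝ (fun v w => B v w - (1 / 2) * (T v w n + T w v n - T n v w))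
    (fun _ _ _ => by
      rw [B.map_add, T.map_add, ContinuousLinearMap.map_add (T _),
        ContinuousLinearMap.map_add (T _)]
      simp only [add_apply]; ring)
    (fun _ _ _ => by
      rw [B.map_smul, T.map_smul, ContinuousLinearMap.map_smul (T _),
        ContinuousLinearMap.map_smul (T _)]
      simp only [smul_apply, smul_eq_mul]; ring)
    (fun _ _ _ => by
      rw [ContinuousLinearMap.map_add (B _), T.map_add, ContinuousLinearMap.map_add (T _),
        ContinuousLinearMap.map_add (T n _)]
      simp only [add_apply]; ring)
    (fun _ _ _ => by
      rw [ContinuousLinearMap.map_smul (B _), T.map_smul, ContinuousLinearMap.map_smul (T _),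
        ContinuousLinearMap.map_smul (T n _)]
      simp only [smul_apply, smul_eq_mul]; ring)

theorem fderiv_apply_const {V : Type*} [NormedAddCommGroup V] [NormedSpace ℝ V]
    {Φ : E → E →L[ℝ] V} {y : E} (hΦ : DifferentiableAt ℝ Φ y) (v h : E) :
    fderiv ℝ (fun z => Φ z v) y h = fderiv ℝ Φ y h v := by
  rw [fderiv_clm_apply hΦ (by fun_prop)]
  simp

theorem differentiableAt_apply_const {V : Type*} [NormedAddCommGroup V] [NormedSpace ℝ V]
    {Φ : E → E →L[ℝ] V} {y : E} (hΦ : DifferentiableAt ℝ Φ y) (v : E) :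
    DifferentiableAt ℝ (fun z => Φ z v) y :=
  hΦ.clm_apply (by fun_prop)

theorem differentiableAt_apply_fderiv {V : Type*} [NormedAddCommGroup V] [NormedSpace ℝ V]
    {Ψ : E → E →L[ℝ] V} {F : E → E} {y : E} (hF : ContDiffAt ℝ 2 F y)
    (hΨ : DifferentiableAt ℝ Ψ y) (v : E) :
    DifferentiableAt ℝ (fun z => Ψ z (fderiv ℝ F z v)) y :=
  hΨ.clm_apply (hF.differentiableAt_fderiv_of_two.clm_apply (by fun_prop))

theorem fderiv_apply_fderiv {V : Type*} [NormedAddCommGroup V] [NormedSpace ℝ V]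
    {Ψ : E → E →L[ℝ] V} {F : E → E} {y : E} (hF : ContDiffAt ℝ 2 F y)
    (hΨ : DifferentiableAt ℝ Ψ y) (v h : E) :
    fderiv ℝ (fun z => Ψ z (fderiv ℝ F z v)) y h =
      fderiv ℝ Ψ y h (fderiv ℝ F y v) + Ψ y (fderiv ℝ (fderiv ℝ F) y h v) := by
  have hDF := hF.differentiableAt_fderiv_of_two
  rw [fderiv_clm_apply hΨ (hDF.clm_apply (by fun_prop)), fderiv_clm_apply hDF (by fun_prop)]
  simp [add_comm]

theorem fderiv_comp_eq {V : Type*} [NormedAddCommGroup V] [NormedSpace ℝ V]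
    {Φ : E → V} {F : E → E} {y : E} (hF : DifferentiableAt ℝ F y)
    (hΦ : DifferentiableAt ℝ Φ (F y)) (h : E) :
    fderiv ℝ (fun z => Φ (F z)) y h = fderiv ℝ Φ (F y) (fderiv ℝ F y h) := by
  rw [fderiv_fun_comp y hΦ hF]
  rfl

theorem differentiableAt_fun_comp {V : Type*} [NormedAddCommGroup V] [NormedSpace ℝ V]
    {Φ : E → V} {F : E → E} {y : E} (hF : DifferentiableAt ℝ F y)
    (hΦ : DifferentiableAt ℝ Φ (F y)) : DifferentiableAt ℝ (fun z => Φ (F z)) y :=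
  hΦ.fun_comp' y hF

local instance bilinNormedAddCommGroup : NormedAddCommGroup (E →L[ℝ] E →L[ℝ] ℝ) :=
  ContinuousLinearMap.toNormedAddCommGroup

local instance bilinNormedSpace : NormedSpace ℝ (E →L[ℝ] E →L[ℝ] ℝ) :=
  ContinuousLinearMap.toNormedSpace

/-- The product rule for a pulled back metric. The last two terms, with the second derivative of
`F`, are the non-tensorial ones that must cancel in the covariant Hessian. -/
theorem fderiv_pullback_bilin {G G' : E → E →L[ℝ] E →L[ℝ] ℝ} {F : E → E}
    {y : E} (hF : ContDiffAt ℝ 2 F y) (hG : DifferentiableAt ℝ G y)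
    (hG' : DifferentiableAt ℝ G' (F y))
    (hpull : ∀ᶠ z in 𝓝 y, ∀ v w, G z v w = G' (F z) (fderiv ℝ F z v) (fderiv ℝ F z w))
    (h v w : E) :
    fderiv ℝ G y h v w =
      fderiv ℝ G' (F y) (fderiv ℝ F y h) (fderiv ℝ F y v) (fderiv ℝ F y w) +
      G' (F y) (fderiv ℝ (fderiv ℝ F) y h v) (fderiv ℝ F y w) +
      G' (F y) (fderiv ℝ F y v) (fderiv ℝ (fderiv ℝ F) y h w) := by
  have hF1 : DifferentiableAt ℝ F y := hF.differentiableAt (by simp)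
  have h3 : (fun z => G z v w) =ᶠ[𝓝 y]
      fun z => G' (F z) (fderiv ℝ F z v) (fderiv ℝ F z w) := by
    filter_upwards [hpull] with z hz
    exact hz v w
  have hc : DifferentiableAt ℝ (fun z => G' (F z)) y := 
    differentiableAt_fun_comp hF1 hG'
  have h4 := fderiv_apply_const (differentiableAt_apply_const hG v) w h
  rw [fderiv_apply_const hG] at h4
  rw [← h4, h3.fderiv_eq, fderiv_apply_fderiv hF (differentiableAt_apply_fderiv hF hc v),
    fderiv_apply_fderiv hF hc, fderiv_comp_eq hF1 hG', add_apply]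

theorem fderiv_fderiv_comp {φ φ' : E → ℝ} {F : E → E} {y : E}
    (hF : ContDiffAt ℝ 2 F y) (hφ' : ContDiffAt ℝ 2 φ' (F y)) (hφ : φ =ᶠ[𝓝 y] φ' ∘ F)
    (v w : E) :
    fderiv ℝ (fderiv ℝ φ) y v w =
      fderiv ℝ (fderiv ℝ φ') (F y) (fderiv ℝ F y v) (fderiv ℝ F y w) +
      fderiv ℝ φ' (F y) (fderiv ℝ (fderiv ℝ F) y v w) := by
  have hF1 : DifferentiableAt ℝ F y := hF.differentiableAt (by simp)
  have hφc : ContDiffAt ℝ 2 φ y := (hφ'.comp y hF).congr_of_eventuallyEq hφ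
  have h0 : (fun z => fderiv ℝ φ z w) =ᶠ[𝓝 y] fun z => fderiv ℝ φ' (F z) (fderiv ℝ F z w) := by
    filter_upwards [hφ.fderiv (𝕜 := ℝ), hF.eventually_differentiableAt,
      hF.continuousAt.eventually hφ'.eventually_differentiableAt] with z h1 h2 h3
    rw [h1, fderiv_comp z h3 h2]
    rfl
  have hc : DifferentiableAt ℝ (fun z => fderiv ℝ φ' (F z)) y :=
    hφ'.differentiableAt_fderiv_of_two.fun_comp' y hF1
  rw [← fderiv_apply_const hφc.differentiableAt_fderiv_of_two, h0.fderiv_eq,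
    fderiv_apply_fderiv hF hc, fderiv_comp_eq hF1 hφ'.differentiableAt_fderiv_of_two]

end CoordinateChange

/-! ### Coordinate invariance of the Laplace-Beltrami operator. -/

section MatrixLaplacian

variable {d : ℕ}

local notation "𝔼" d => EuclideanSpace ℝ (Fin d)

theorem EuclideanSpace.eq_sum_smul_single (v : 𝔼 d) :
    v = ∑ a, v a • EuclideanSpace.single a (1 : ℝ) := by
  ext i
  simp [Pi.single_apply]

/-- The matrix of a bilinear form on `ℝ^d` in the standard basis. -/
def bilinMatrix (B : (𝔼 d) →ₗ[ℝ] (𝔼 d) →ₗ[ℝ] ℝ) : Matrix (Fin d) (Fin d) ℝ :=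
  Matrix.of fun i j => B (EuclideanSpace.single i 1) (EuclideanSpace.single j 1)

/-- The matrix of an endomorphism of `ℝ^d` in the standard basis. -/
def endMatrix (A : (𝔼 d) →L[ℝ] 𝔼 d) : Matrix (Fin d) (Fin d) ℝ :=
  Matrix.of fun i j => A (EuclideanSpace.single j 1) i

theorem bilinMatrix_comp (B : (𝔼 d) →ₗ[ℝ] (𝔼 d) →ₗ[ℝ] ℝ) (A : (𝔼 d) →L[ℝ] 𝔼 d) :
    (Matrix.of fun i j => B (A (EuclideanSpace.single i 1)) (A (EuclideanSpace.single j 1))) =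
      (endMatrix A).transpose * bilinMatrix B * endMatrix A := by
  ext i j
  simp only [Matrix.of_apply, Matrix.mul_apply, Matrix.transpose_apply, Finset.sum_mul]
  conv_lhs => rw [EuclideanSpace.eq_sum_smul_single (A (EuclideanSpace.single i 1)),
    EuclideanSpace.eq_sum_smul_single (A (EuclideanSpace.single j 1))]
  simp only [map_sum, map_smul, LinearMap.sum_apply, LinearMap.smul_apply, smul_eq_mul]
  refine Finset.sum_congr rfl fun b _ => ?_
  rw [Finset.mul_sum]
  refine Finset.sum_congr rfl fun a _ => ?_
  simp [endMatrix, bilinMatrix]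
  ring

/-- Here `G⁻¹ = A⁻¹ G'⁻¹ A⁻ᵀ`, and the factors of `A` cancel by cyclicity of the trace. This is the
metric trace of a tensor being independent of the basis. -/
theorem trace_inv_mul_congr {A G G' H H' : Matrix (Fin d) (Fin d) ℝ}
    (hG : G = A.transpose * G' * A) (hH : H = A.transpose * H' * A) (hA : A.det ≠ 0) :
    ∑ i, ∑ j, G⁻¹ i j * H i j = ∑ i, ∑ j, G'⁻¹ i j * H' i j := by
  have key : ∀ P Q : Matrix (Fin d) (Fin d) ℝ,
      ∑ i, ∑ j, P i j * Q i j = (P * Q.transpose).trace := by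
    intro P Q
    simp [Matrix.trace, Matrix.mul_apply]
  have hA' : IsUnit A.det := isUnit_iff_ne_zero.2 hA
  have hAt : IsUnit A.transpose.det := by rwa [Matrix.det_transpose]
  rw [key, key, hG, hH, Matrix.mul_inv_rev, Matrix.mul_inv_rev, Matrix.transpose_mul,
    Matrix.transpose_mul, Matrix.transpose_transpose]
  have h1 : A⁻¹ * (G'⁻¹ * A.transpose⁻¹) * (A.transpose * (H'.transpose * A)) =
      A⁻¹ * (G'⁻¹ * H'.transpose * A) := by
    calc _ = A⁻¹ * (G'⁻¹ * ((A.transpose⁻¹ * A.transpose) * (H'.transpose * A))) := by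
          simp only [Matrix.mul_assoc]
      _ = _ := by rw [Matrix.nonsing_inv_mul _ hAt]; simp only [Matrix.one_mul, Matrix.mul_assoc]
  rw [h1, Matrix.trace_mul_comm, Matrix.mul_assoc, Matrix.mul_nonsing_inv _ hA', Matrix.mul_one]

/-- The Laplace-Beltrami operator of the metric with matrix `Gm` on `ℝ^d`. -/
def matrixLaplacian (Gm : (𝔼 d) → Matrix (Fin d) (Fin d) ℝ) (φ : (𝔼 d) → ℝ) (y : 𝔼 d) : ℝ :=
  ∑ i, ∑ j, (Gm y)⁻¹ i j *
    (partialD i (partialD j φ) y - ∑ k, ((1 / 2) * ∑ l, (Gm y)⁻¹ k l *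
      (partialD i (fun z => Gm z j l) y + partialD j (fun z => Gm z i l) y
        - partialD l (fun z => Gm z i j) y)) * partialD k φ y)

/-- A continuous bilinear form, as a plain bilinear map. -/
def clmBilin (B : (𝔼 d) →L[ℝ] (𝔼 d) →L[ℝ] ℝ) : (𝔼 d) →ₗ[ℝ] (𝔼 d) →ₗ[ℝ] ℝ :=
  LinearMap.mk₂ ℝ (fun v w => B v w) (by simp) (by simp) (by simp) (by simp)

/-- The gradient of `φ` with respect to the metric `G`. -/
def bilinGradient (G : (𝔼 d) → (𝔼 d) →L[ℝ] (𝔼 d) →L[ℝ] ℝ) (φ : (𝔼 d) → ℝ) (y : 𝔼 d) : 𝔼 d :=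
  ∑ l, (∑ k, (bilinMatrix (clmBilin (G y)))⁻¹ k l * partialD k φ y) • EuclideanSpace.single l 1

theorem bilinGradient_apply {G : (𝔼 d) → (𝔼 d) →L[ℝ] (𝔼 d) →L[ℝ] ℝ} {φ : (𝔼 d) → ℝ} {y : 𝔼 d}
    (hdet : (bilinMatrix (clmBilin (G y))).det ≠ 0) (w : 𝔼 d) :
    G y (bilinGradient G φ y) w = fderiv ℝ φ y w := by
  have hj : ∀ j : Fin d, G y (bilinGradient G φ y) (EuclideanSpace.single j 1) =
      fderiv ℝ φ y (EuclideanSpace.single j 1) := by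
    intro j
    simp only [bilinGradient, map_sum, map_smul, sum_apply, smul_apply, smul_eq_mul,
      Finset.sum_mul]
    rw [Finset.sum_comm]
    have h1 : ∀ k, ∑ l, (bilinMatrix (clmBilin (G y)))⁻¹ k l * partialD k φ y *
        G y (EuclideanSpace.single l 1) (EuclideanSpace.single j 1) =
        ((bilinMatrix (clmBilin (G y)))⁻¹ * bilinMatrix (clmBilin (G y))) k j *
          partialD k φ y := by
      intro k
      rw [Matrix.mul_apply, Finset.sum_mul]
      refine Finset.sum_congr rfl fun l _ => ?_
      simp only [bilinMatrix, clmBilin, Matrix.of_apply, LinearMap.mk₂_apply]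
      ring
    simp only [h1, Matrix.nonsing_inv_mul _ (isUnit_iff_ne_zero.2 hdet), Matrix.one_apply]
    simp [partialD]
  conv_lhs => rw [EuclideanSpace.eq_sum_smul_single w]
  conv_rhs => rw [EuclideanSpace.eq_sum_smul_single w]
  simp only [map_sum, map_smul, hj]

-- The raised index of the Christoffel symbol is moved onto `∂_k φ`, which becomes the gradient.
-- What remains is a Christoffel symbol of the first kind, linear in the derivative of the metric,
-- so no inverse matrix has to be differentiated.
set_option synthInstance.maxHeartbeats 200000 in
set_option maxHeartbeats 1000000 in
theorem matrixLaplacian_eq_trace {G : (𝔼 d) → (𝔼 d) →L[ℝ] (𝔼 d) →L[ℝ] ℝ} {φ : (𝔼 d) → ℝ}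
    {y : 𝔼 d} (hG : DifferentiableAt ℝ G y) (hφ : ContDiffAt ℝ 2 φ y) :
    matrixLaplacian (fun z => bilinMatrix (clmBilin (G z))) φ y =
      ∑ i, ∑ j, (bilinMatrix (clmBilin (G y)))⁻¹ i j *
        bilinMatrix (koszulForm (fderiv ℝ (fderiv ℝ φ) y) (fderiv ℝ G y)
          (bilinGradient G φ y)) i j := by
  unfold matrixLaplacian
  have hp : ∀ i j l : Fin d, partialD i (fun z => bilinMatrix (clmBilin (G z)) j l) y =
      fderiv ℝ G y (EuclideanSpace.single i 1) (EuclideanSpace.single j 1)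
        (EuclideanSpace.single l 1) := by
    intro i j l
    simp only [bilinMatrix, clmBilin, Matrix.of_apply, LinearMap.mk₂_apply, partialD]
    rw [fderiv_apply_const (differentiableAt_apply_const hG _), fderiv_apply_const hG]
  refine Finset.sum_congr rfl fun i _ => Finset.sum_congr rfl fun j _ => ?_
  congr 1
  rw [partialD_partialD hφ]
  simp only [hp]
  conv_rhs => rw [bilinMatrix]
  simp only [Matrix.of_apply, koszulForm, LinearMap.mk₂_apply]
  congr 1
  simp only [bilinGradient, map_sum, map_smul, sum_apply, smul_apply, smul_eq_mul]
  rw [← Finset.sum_add_distrib, ← Finset.sum_sub_distrib, Finset.mul_sum]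
  simp only [Finset.mul_sum, Finset.sum_mul, ← Finset.sum_add_distrib, ← Finset.sum_sub_distrib]
  rw [Finset.sum_comm]
  refine Finset.sum_congr rfl fun l _ => Finset.sum_congr rfl fun k _ => ?_
  ring

/-- The Laplace-Beltrami operator does not depend on the coordinates. -/
theorem matrixLaplacian_comp {G G' : (𝔼 d) → (𝔼 d) →L[ℝ] (𝔼 d) →L[ℝ] ℝ} {φ φ' : (𝔼 d) → ℝ}
    {F : (𝔼 d) → 𝔼 d} {y : 𝔼 d} (hF : ContDiffAt ℝ 2 F y) (hG : DifferentiableAt ℝ G y)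
    (hG' : DifferentiableAt ℝ G' (F y)) (hsymm : ∀ v w, G' (F y) v w = G' (F y) w v)
    (hpull : ∀ᶠ z in 𝓝 y, ∀ v w, G z v w = G' (F z) (fderiv ℝ F z v) (fderiv ℝ F z w))
    (hdet : (bilinMatrix (clmBilin (G y))).det ≠ 0)
    (hφ' : ContDiffAt ℝ 2 φ' (F y)) (hφ : φ =ᶠ[𝓝 y] φ' ∘ F) :
    matrixLaplacian (fun z => bilinMatrix (clmBilin (G z))) φ y =
      matrixLaplacian (fun z => bilinMatrix (clmBilin (G' z))) φ' (F y) := by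
  have hφc : ContDiffAt ℝ 2 φ y := (hφ'.comp y hF).congr_of_eventuallyEq hφ
  set A := fderiv ℝ F y with hA
  have hGm : bilinMatrix (clmBilin (G y)) =
      (endMatrix A).transpose * bilinMatrix (clmBilin (G' (F y))) * endMatrix A := by
    rw [← bilinMatrix_comp]
    ext i j
    simp only [bilinMatrix, clmBilin, Matrix.of_apply, LinearMap.mk₂_apply]
    exact hpull.self_of_nhds _ _
  have hdets : (endMatrix A).det ≠ 0 ∧ (bilinMatrix (clmBilin (G' (F y)))).det ≠ 0 := by
    rw [hGm, Matrix.det_mul, Matrix.det_mul] at hdet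
    exact ⟨right_ne_zero_of_mul hdet, right_ne_zero_of_mul (left_ne_zero_of_mul hdet)⟩
  have hsurj : Function.Surjective A := by
    intro w
    set q := Matrix.mulVec (endMatrix A)⁻¹ (fun i => w i) with hq
    refine ⟨∑ j, q j • EuclideanSpace.single j 1, ?_⟩
    have h2 : Matrix.mulVec (endMatrix A) q = fun i => w i := by
      rw [hq, Matrix.mulVec_mulVec, Matrix.mul_nonsing_inv _ (isUnit_iff_ne_zero.2 hdets.1),
        Matrix.one_mulVec]
    ext i
    rw [← congrFun h2 i]
    simp [Matrix.mulVec, dotProduct, endMatrix, mul_comm]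
  have hfd : ∀ w, fderiv ℝ φ y w = fderiv ℝ φ' (F y) (A w) := by
    intro w
    rw [hφ.fderiv_eq, fderiv_comp y (hφ'.differentiableAt (by simp))
      (hF.differentiableAt (by simp))]
    rfl
  -- Both sides represent the same differential with respect to `G'`, tested on all vectors since
  -- `A` is surjective; `G'` is nondegenerate.
  have hgrad : A (bilinGradient G φ y) = bilinGradient G' φ' (F y) := by
    have h1 : ∀ w, G' (F y) (A (bilinGradient G φ y) - bilinGradient G' φ' (F y)) w = 0 := by
      intro w
      obtain ⟨w, rfl⟩ := hsurj w
      rw [map_sub, sub_apply, bilinGradient_apply hdets.2, ← hpull.self_of_nhds,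
        bilinGradient_apply hdet, hfd, sub_self]
    by_contra hne
    set n := A (bilinGradient G φ y) - bilinGradient G' φ' (F y) with hn
    have hn0 : (fun i => n i) ≠ 0 := by
      intro h
      apply hne
      rw [← sub_eq_zero, ← hn]
      ext i
      exact congrFun h i
    apply hdets.2
    rw [← Matrix.exists_vecMul_eq_zero_iff]
    refine ⟨_, hn0, ?_⟩
    ext j
    have := h1 (EuclideanSpace.single j 1)
    rw [EuclideanSpace.eq_sum_smul_single n] at this
    simpa [Matrix.vecMul, dotProduct, bilinMatrix, clmBilin] using this
  rw [matrixLaplacian_eq_trace hG hφc, matrixLaplacian_eq_trace hG' hφ']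
  refine trace_inv_mul_congr hGm ?_ hdets.1
  rw [← bilinMatrix_comp]
  ext i j
  simp only [bilinMatrix, Matrix.of_apply, koszulForm, LinearMap.mk₂_apply]
  set v : 𝔼 d := EuclideanSpace.single i 1
  set w : 𝔼 d := EuclideanSpace.single j 1
  set n := bilinGradient G φ y
  have hS : ∀ v w, fderiv ℝ (fderiv ℝ F) y v w = fderiv ℝ (fderiv ℝ F) y w v := fun v w =>
    (hF.isSymmSndFDerivAt (by simp)) v w
  -- In the combination `T v w n + T w v n - T n v w` the second derivatives of `F` collapse, by
  -- symmetry, to twice the right-hand side. This cancels the extra term in the Hessian of `φ' ∘ F`.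
  have hlast : fderiv ℝ φ' (F y) (fderiv ℝ (fderiv ℝ F) y v w) =
      G' (F y) (fderiv ℝ (fderiv ℝ F) y v w) (A n) := by
    rw [hgrad, hsymm, bilinGradient_apply hdets.2]
  rw [fderiv_fderiv_comp hF hφ' hφ, hlast, ← hgrad,
    fderiv_pullback_bilin hF hG hG' hpull, fderiv_pullback_bilin hF hG hG' hpull,
    fderiv_pullback_bilin hF hG hG' hpull, ← hA, hS w v, hS n v, hS n w,
    hsymm (fderiv ℝ (fderiv ℝ F) y v n) (A w)]
  ring

end MatrixLaplacian
end

noncomputable section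

/-! ### The metric read in a chart: positivity and smoothness. -/

section Geometry

variable {d : ℕ} {M : Type*} [TopologicalSpace M]
  [ChartedSpace (EuclideanSpace ℝ (Fin d)) M] [IsManifold (𝓡 d) ∞ M]

local notation "𝔼" d => EuclideanSpace ℝ (Fin d)

local instance modelChartedSpace : ChartedSpace (𝔼 d) (𝔼 d) := chartedSpaceSelf _

/-- The derivative of the inverse of the chart `e`, as an endomorphism of the model space. -/
def chartSymmDeriv (e : OpenPartialHomeomorph M (𝔼 d)) (y : 𝔼 d) : (𝔼 d) →L[ℝ] (𝔼 d) :=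
  mfderiv (𝓡 d) (𝓡 d) e.symm y

/-- The scalar product at `x` as a bilinear form on the model space. -/
def modelInner (g : SmoothMetric d M) (x : M) : (𝔼 d) →L[ℝ] (𝔼 d) →L[ℝ] ℝ := g.inner x

/-- The metric read in the chart `e`. -/
def metricForm (g : SmoothMetric d M) (e : OpenPartialHomeomorph M (𝔼 d)) (y : 𝔼 d) :
    (𝔼 d) →L[ℝ] (𝔼 d) →L[ℝ] ℝ :=
  (modelInner g (e.symm y)).bilinearComp (chartSymmDeriv e y) (chartSymmDeriv e y)

theorem coordMatrix_eq_bilinMatrix (g : SmoothMetric d M) (e : OpenPartialHomeomorph M (𝔼 d)) :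
    g.coordMatrix e = fun y => bilinMatrix (clmBilin (metricForm g e y)) := rfl

theorem laplacianInChart_eq_matrixLaplacian (g : SmoothMetric d M)
    (e : OpenPartialHomeomorph M (𝔼 d)) (u : M → ℝ) (x : M) :
    g.laplacianInChart e u x = matrixLaplacian (fun y => bilinMatrix (clmBilin (metricForm g e y)))
      (u ∘ e.symm) (e x) := rfl

theorem modelInner_symm (g : SmoothMetric d M) (x : M) (v w : 𝔼 d) :
    modelInner g x v w = modelInner g x w v := g.symm x v w

theorem modelInner_pos (g : SmoothMetric d M) (x : M) (v : 𝔼 d) (hv : v ≠ 0) :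
    0 < modelInner g x v v := g.pos x v hv

theorem metricForm_symm (g : SmoothMetric d M) (e : OpenPartialHomeomorph M (𝔼 d)) (y v w : 𝔼 d) :
    metricForm g e y v w = metricForm g e y w v := modelInner_symm g _ _ _

theorem chartSymmDeriv_injective (x₀ : M) {y : 𝔼 d} (hy : y ∈ (chartAt (𝔼 d) x₀).target) :
    Function.Injective (chartSymmDeriv (chartAt (𝔼 d) x₀) y) := by
  have : IsManifold (𝓡 d) 1 M := .of_le (n := ∞) (by simp)
  exact (mdifferentiable_chart (I := 𝓡 d) x₀).symm.mfderiv_injective hy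

theorem metricForm_pos (g : SmoothMetric d M) (x₀ : M) {y : 𝔼 d}
    (hy : y ∈ (chartAt (𝔼 d) x₀).target) {v : 𝔼 d} (hv : v ≠ 0) :
    0 < metricForm g (chartAt (𝔼 d) x₀) y v v := by
  apply modelInner_pos
  intro h
  exact hv (chartSymmDeriv_injective x₀ hy (h.trans (map_zero _).symm))

theorem posDef_coordMatrix (g : SmoothMetric d M) (x₀ : M) {y : 𝔼 d}
    (hy : y ∈ (chartAt (𝔼 d) x₀).target) :
    (g.coordMatrix (chartAt (𝔼 d) x₀) y).PosDef := by
  refine Matrix.PosDef.of_dotProduct_mulVec_pos ?_ fun v hv => ?_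
  · ext i j
    exact metricForm_symm g _ y _ _
  · have h0 : WithLp.toLp 2 v ≠ 0 := fun h => hv (by simpa using congrArg WithLp.ofLp h)
    have h1 := metricForm_pos g x₀ hy h0
    rw [EuclideanSpace.eq_sum_smul_single (WithLp.toLp 2 v)] at h1
    simp only [map_sum, map_smul, sum_apply, smul_apply, smul_eq_mul] at h1
    refine h1.trans_eq ?_
    simp only [dotProduct, Matrix.mulVec, star_trivial, Finset.mul_sum]
    rw [Finset.sum_comm]
    refine Finset.sum_congr rfl fun i _ => Finset.sum_congr rfl fun j _ => ?_
    simp only [coordMatrix_eq_bilinMatrix, bilinMatrix, clmBilin, Matrix.of_apply,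
      LinearMap.mk₂_apply]
    ring

/-- This is the tangent map of the inverse chart applied to a constant section of the tangent bundle
of `ℝ^d`. -/
theorem contMDiffOn_coordinate_field (x₀ : M) (v : 𝔼 d) :
    ContMDiffOn (𝓡 d) ((𝓡 d).prod (𝓡 d)) ∞
      (fun y => (⟨(chartAt (𝔼 d) x₀).symm y, chartSymmDeriv (chartAt (𝔼 d) x₀) y v⟩ :
        TangentBundle (𝓡 d) M)) (chartAt (𝔼 d) x₀).target := by
  have : IsManifold (𝓡 d) 1 M := .of_le (n := ∞) (by simp)
  set e := chartAt (𝔼 d) x₀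
  have h1 : ContMDiffOn (𝓡 d) (𝓡 d) ∞ e.symm e.target := contMDiffOn_chart_symm
  have h2 := h1.contMDiffOn_tangentMapWithin (m := ∞) (by simp) e.open_target.uniqueMDiffOn
  have h3 : ContMDiff (𝓡 d) ((𝓡 d).prod (𝓡 d)) ∞
      (fun y : 𝔼 d => (⟨y, v⟩ : TangentBundle (𝓡 d) (𝔼 d))) :=
    contMDiff_vectorSpace_iff_contDiff.2 (contDiff_const (c := v))
  have h4 := h2.comp h3.contMDiffOn (s := e.target) (fun y hy => hy)
  refine h4.congr fun y hy => ?_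
  simp only [Function.comp, tangentMapWithin]
  rw [mfderivWithin_of_isOpen e.open_target hy]
  rfl

theorem contDiffOn_metricForm (g : SmoothMetric d M) (x₀ : M) :
    ContDiffOn ℝ ∞ (metricForm g (chartAt (𝔼 d) x₀)) (chartAt (𝔼 d) x₀).target := by
  have : IsManifold (𝓡 d) 1 M := .of_le (n := ∞) (by simp)
  set e := chartAt (𝔼 d) x₀
  have h1 : ContMDiffOn (𝓡 d) (𝓡 d) ∞ e.symm e.target := contMDiffOn_chart_symm
  rw [contDiffOn_clm_apply]
  intro v
  rw [contDiffOn_clm_apply]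
  intro w
  rw [← contMDiffOn_iff_contDiffOn]
  have hg := g.contMDiff.comp_contMDiffOn h1
  intro y hy
  have := ContMDiffWithinAt.clm_bundle_apply₂ (F₁ := 𝔼 d) (F₂ := 𝔼 d) (F₃ := ℝ)
    (E₃ := Bundle.Trivial M ℝ) (hg y hy)
    (contMDiffOn_coordinate_field x₀ v y hy) (contMDiffOn_coordinate_field x₀ w y hy)
  simp only [contMDiffWithinAt_totalSpace] at this
  exact this.2

end Geometry
end

noncomputable section

/-! ### Transition maps and vector fields in charts. -/

section Geometry

variable {d : ℕ} {M : Type*} [TopologicalSpace M]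
  [ChartedSpace (EuclideanSpace ℝ (Fin d)) M]

local notation "𝔼" d => EuclideanSpace ℝ (Fin d)

attribute [local instance] modelChartedSpace

theorem two_le_infty : (2 : WithTop ℕ∞) ≤ ∞ := WithTop.coe_le_coe.2 le_top

/-- The change of coordinates between two preferred charts. -/
def coordChange (x₀ x₁ : M) : (𝔼 d) → 𝔼 d := chartAt (𝔼 d) x₁ ∘ (chartAt (𝔼 d) x₀).symm

theorem eventually_mem_chart_overlap (x₀ x₁ : M) {y : 𝔼 d} (hy : y ∈ (chartAt (𝔼 d) x₀).target)
    (hy' : (chartAt (𝔼 d) x₀).symm y ∈ (chartAt (𝔼 d) x₁).source) :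
    ∀ᶠ z in 𝓝 y, z ∈ (chartAt (𝔼 d) x₀).target ∧
      (chartAt (𝔼 d) x₀).symm z ∈ (chartAt (𝔼 d) x₁).source :=
  Filter.Eventually.and ((chartAt (𝔼 d) x₀).open_target.mem_nhds hy)
    (((chartAt (𝔼 d) x₀).continuousAt_symm hy).eventually
      ((chartAt (𝔼 d) x₁).open_source.mem_nhds hy'))

theorem chart_symm_coordChange (x₀ x₁ : M) {y : 𝔼 d}
    (hy' : (chartAt (𝔼 d) x₀).symm y ∈ (chartAt (𝔼 d) x₁).source) :
    (chartAt (𝔼 d) x₁).symm (coordChange x₀ x₁ y) = (chartAt (𝔼 d) x₀).symm y :=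
  (chartAt (𝔼 d) x₁).left_inv hy'

variable [IsManifold (𝓡 d) ∞ M]

theorem contDiffAt_comp_chart_symm {n : WithTop ℕ∞} (hn : n ≤ ∞) (x₀ : M) {V : Type*}
    [NormedAddCommGroup V] [NormedSpace ℝ V] {φ : M → V} {y : 𝔼 d}
    (hy : y ∈ (chartAt (𝔼 d) x₀).target)
    (hφ : ContMDiffAt (𝓡 d) 𝓘(ℝ, V) n φ ((chartAt (𝔼 d) x₀).symm y)) :
    ContDiffAt ℝ n (φ ∘ (chartAt (𝔼 d) x₀).symm) y := by
  rw [← contMDiffAt_iff_contDiffAt]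
  have h1 : ContMDiffAt (𝓡 d) (𝓡 d) ∞ (chartAt (𝔼 d) x₀).symm y :=
    contMDiffOn_chart_symm.contMDiffAt ((chartAt (𝔼 d) x₀).open_target.mem_nhds hy)
  exact hφ.comp y (h1.of_le hn)

theorem contDiffAt_coordChange (x₀ x₁ : M) {y : 𝔼 d} (hy : y ∈ (chartAt (𝔼 d) x₀).target)
    (hy' : (chartAt (𝔼 d) x₀).symm y ∈ (chartAt (𝔼 d) x₁).source) :
    ContDiffAt ℝ 2 (coordChange x₀ x₁) y :=
  contDiffAt_comp_chart_symm two_le_infty x₀ hy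
    ((contMDiffOn_chart (n := ∞)).contMDiffAt
      ((chartAt (𝔼 d) x₁).open_source.mem_nhds hy') |>.of_le two_le_infty)

theorem chartSymmDeriv_coordChange (x₀ x₁ : M) {y : 𝔼 d} (hy : y ∈ (chartAt (𝔼 d) x₀).target)
    (hy' : (chartAt (𝔼 d) x₀).symm y ∈ (chartAt (𝔼 d) x₁).source) (v : 𝔼 d) :
    chartSymmDeriv (chartAt (𝔼 d) x₀) y v =
      chartSymmDeriv (chartAt (𝔼 d) x₁) (coordChange x₀ x₁ y)
        (fderiv ℝ (coordChange x₀ x₁) y v) := by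
  have : IsManifold (𝓡 d) 1 M := .of_le (n := ∞) (by simp)
  have heq : (chartAt (𝔼 d) x₀).symm =ᶠ[𝓝 y] (chartAt (𝔼 d) x₁).symm ∘ coordChange x₀ x₁ := by
    filter_upwards [eventually_mem_chart_overlap x₀ x₁ hy hy'] with z hz
    exact (chart_symm_coordChange x₀ x₁ hz.2).symm
  have hF : MDifferentiableAt (𝓡 d) (𝓡 d) (coordChange x₀ x₁) y :=
    ((contDiffAt_coordChange x₀ x₁ hy hy').differentiableAt (by simp)).mdifferentiableAt
  have ht : coordChange x₀ x₁ y ∈ (chartAt (𝔼 d) x₁).target := (chartAt (𝔼 d) x₁).map_source hy'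
  have he : MDifferentiableAt (𝓡 d) (𝓡 d) (chartAt (𝔼 d) x₁).symm (coordChange x₀ x₁ y) :=
    mdifferentiableAt_atlas_symm (chart_mem_atlas _ _) ht
  have h1 : HasMFDerivAt (𝓡 d) (𝓡 d) (chartAt (𝔼 d) x₀).symm y
      ((mfderiv (𝓡 d) (𝓡 d) (chartAt (𝔼 d) x₁).symm (coordChange x₀ x₁ y)).comp
        (mfderiv (𝓡 d) (𝓡 d) (coordChange x₀ x₁) y)) :=
    (he.hasMFDerivAt.comp y hF.hasMFDerivAt).congr_of_eventuallyEq heq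
  have h2 : mfderiv (𝓡 d) (𝓡 d) (coordChange x₀ x₁) y = fderiv ℝ (coordChange x₀ x₁) y :=
    mfderiv_eq_fderiv
  have h3 := h1.mfderiv
  rw [h2] at h3
  exact congrArg (fun T : (𝔼 d) →L[ℝ] (𝔼 d) => T v) h3

theorem metricForm_coordChange (g : SmoothMetric d M) (x₀ x₁ : M) {y : 𝔼 d}
    (hy : y ∈ (chartAt (𝔼 d) x₀).target)
    (hy' : (chartAt (𝔼 d) x₀).symm y ∈ (chartAt (𝔼 d) x₁).source) (v w : 𝔼 d) :
    metricForm g (chartAt (𝔼 d) x₀) y v w =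
      metricForm g (chartAt (𝔼 d) x₁) (coordChange x₀ x₁ y)
        (fderiv ℝ (coordChange x₀ x₁) y v) (fderiv ℝ (coordChange x₀ x₁) y w) := by
  simp only [metricForm, ContinuousLinearMap.bilinearComp_apply]
  rw [chart_symm_coordChange x₀ x₁ hy', ← chartSymmDeriv_coordChange x₀ x₁ hy hy',
    ← chartSymmDeriv_coordChange x₀ x₁ hy hy']

theorem differentiableAt_metricForm (g : SmoothMetric d M) (x₀ : M) {y : 𝔼 d}
    (hy : y ∈ (chartAt (𝔼 d) x₀).target) :
    DifferentiableAt ℝ (metricForm g (chartAt (𝔼 d) x₀)) y :=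
  ((contDiffOn_metricForm g x₀).contDiffAt
    ((chartAt (𝔼 d) x₀).open_target.mem_nhds hy)).differentiableAt (by simp)

/-- The Laplace-Beltrami operator may be computed in any preferred chart around the point. -/
theorem laplacianInChart_eq (g : SmoothMetric d M) (x₀ x₁ : M) {φ : M → ℝ} {x : M}
    (hx₀ : x ∈ (chartAt (𝔼 d) x₀).source) (hx₁ : x ∈ (chartAt (𝔼 d) x₁).source)
    (hφ : ContMDiffAt (𝓡 d) 𝓘(ℝ, ℝ) 2 φ x) :
    g.laplacianInChart (chartAt (𝔼 d) x₀) φ x = g.laplacianInChart (chartAt (𝔼 d) x₁) φ x := by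
  rw [laplacianInChart_eq_matrixLaplacian, laplacianInChart_eq_matrixLaplacian]
  have hy : chartAt (𝔼 d) x₀ x ∈ (chartAt (𝔼 d) x₀).target := (chartAt (𝔼 d) x₀).map_source hx₀
  have hyx : (chartAt (𝔼 d) x₀).symm (chartAt (𝔼 d) x₀ x) = x := (chartAt (𝔼 d) x₀).left_inv hx₀
  have hy' : (chartAt (𝔼 d) x₀).symm (chartAt (𝔼 d) x₀ x) ∈ (chartAt (𝔼 d) x₁).source := by
    rwa [hyx]
  have hFx : coordChange x₀ x₁ (chartAt (𝔼 d) x₀ x) = chartAt (𝔼 d) x₁ x := by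
    simp only [coordChange, Function.comp, hyx]
  have ht : chartAt (𝔼 d) x₁ x ∈ (chartAt (𝔼 d) x₁).target := (chartAt (𝔼 d) x₁).map_source hx₁
  rw [← hFx]
  refine matrixLaplacian_comp (contDiffAt_coordChange x₀ x₁ hy hy')
    (differentiableAt_metricForm g x₀ hy) (by rw [hFx]; exact differentiableAt_metricForm g x₁ ht)
    (metricForm_symm g _ _) ?_ (posDef_coordMatrix g x₀ hy).det_pos.ne' ?_ ?_
  · filter_upwards [eventually_mem_chart_overlap x₀ x₁ hy hy'] with z hz v w
    exact metricForm_coordChange g x₀ x₁ hz.1 hz.2 v w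
  · rw [hFx]
    refine contDiffAt_comp_chart_symm two_le_infty x₁ ht ?_
    rwa [(chartAt (𝔼 d) x₁).left_inv hx₁]
  · filter_upwards [eventually_mem_chart_overlap x₀ x₁ hy hy'] with z hz
    simp only [Function.comp]
    rw [chart_symm_coordChange x₀ x₁ hz.2]

/-- The operator `φ ↦ Δ_g φ + ⟨X, ∇φ⟩`. -/
def driftLaplacian (g : SmoothMetric d M) (X : ∀ x : M, TangentSpace (𝓡 d) x) (φ : M → ℝ)
    (x : M) : ℝ :=
  g.laplacian φ x + g.inner x (X x) (g.gradient φ x)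

/-- The vector field `X` read in the chart `e`. -/
def fieldInChart (X : ∀ x : M, TangentSpace (𝓡 d) x) (e : OpenPartialHomeomorph M (𝔼 d))
    (y : 𝔼 d) : 𝔼 d :=
  mfderiv (𝓡 d) (𝓡 d) e (e.symm y) (X (e.symm y))

theorem continuousOn_fieldInChart {X : ∀ x : M, TangentSpace (𝓡 d) x}
    (hX : Continuous fun x => (⟨x, X x⟩ : TangentBundle (𝓡 d) M)) (x₀ : M) :
    ContinuousOn (fieldInChart X (chartAt (𝔼 d) x₀)) (chartAt (𝔼 d) x₀).target := by
  have : IsManifold (𝓡 d) 1 M := .of_le (n := ∞) (by simp)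
  set e := chartAt (𝔼 d) x₀ with he
  have h1 : ContMDiffOn (𝓡 d) (𝓡 d) ∞ e e.source := contMDiffOn_chart
  have h2 := h1.continuousOn_tangentMapWithin (by simp) e.open_source.uniqueMDiffOn
  have h3 : ContinuousOn (fun x => tangentMapWithin (𝓡 d) (𝓡 d) e e.source
      (⟨x, X x⟩ : TangentBundle (𝓡 d) M)) e.source := h2.comp hX.continuousOn (fun x hx => hx)
  have h4 := h3.comp e.continuousOn_symm e.symm.mapsTo
  have h5 : Continuous (fun p : TangentBundle (𝓡 d) (𝔼 d) =>
      (tangentBundleModelSpaceHomeomorph (𝓡 d) p).2) :=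
    continuous_snd.comp (tangentBundleModelSpaceHomeomorph (𝓡 d)).continuous
  refine (h5.comp_continuousOn h4).congr fun y hy => ?_
  simp only [Function.comp, tangentMapWithin, fieldInChart, tangentBundleModelSpaceHomeomorph_coe]
  rw [mfderivWithin_of_isOpen e.open_source (e.map_target hy)]
  rfl

theorem inner_gradient_eq_fderiv (g : SmoothMetric d M) (X : ∀ x : M, TangentSpace (𝓡 d) x)
    (x₀ : M) {φ : M → ℝ} {x : M} (hx : x ∈ (chartAt (𝔼 d) x₀).source)
    (hφ : ContMDiffAt (𝓡 d) 𝓘(ℝ, ℝ) 2 φ x) :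
    g.inner x (X x) (g.gradient φ x) = fderiv ℝ (φ ∘ (chartAt (𝔼 d) x₀).symm)
      (chartAt (𝔼 d) x₀ x) (fieldInChart X (chartAt (𝔼 d) x₀) (chartAt (𝔼 d) x₀ x)) := by
  have : IsManifold (𝓡 d) 1 M := .of_le (n := ∞) (by simp)
  set e := chartAt (𝔼 d) x₀ with he
  rw [g.symm, SmoothMetric.inner_gradient]
  have hxy : e.symm (e x) = x := e.left_inv hx
  have hd : DifferentiableAt ℝ (φ ∘ e.symm) (e x) :=
    (contDiffAt_comp_chart_symm (n := 2) two_le_infty x₀ (e.map_source hx)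
      (by rw [← he, hxy]; exact hφ)).differentiableAt (by simp)
  have heq : φ =ᶠ[𝓝 x] (φ ∘ e.symm) ∘ e := by
    filter_upwards [e.open_source.mem_nhds hx] with z hz
    simp [e.left_inv hz]
  have hme : MDifferentiableAt (𝓡 d) (𝓡 d) e x := mdifferentiableAt_atlas (chart_mem_atlas _ _) hx
  have h1 : HasMFDerivAt (𝓡 d) 𝓘(ℝ, ℝ) φ x
      ((mfderiv (𝓡 d) 𝓘(ℝ, ℝ) (φ ∘ e.symm) (e x)).comp (mfderiv (𝓡 d) (𝓡 d) e x)) :=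
    (hd.mdifferentiableAt.hasMFDerivAt.comp x hme.hasMFDerivAt).congr_of_eventuallyEq heq
  rw [h1.mfderiv, mfderiv_eq_fderiv]
  unfold fieldInChart
  rw [hxy]
  rfl

end Geometry
end

noncomputable section

/-! ### The operator `Δ_g + ⟨X, ∇·⟩` in a fixed chart, and the strong minimum principle on the
manifold. -/

section EllipticOp

variable {d : ℕ}

local notation "𝔼" d => EuclideanSpace ℝ (Fin d)

theorem ellipticOp_const (a : (𝔼 d) → Matrix (Fin d) (Fin d) ℝ) (b : (𝔼 d) → 𝔼 d) (r : ℝ)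
    (y : 𝔼 d) : ellipticOp a b (fun _ => r) y = 0 := by
  have h : ∀ j : Fin d, partialD j (fun _ : 𝔼 d => r) = fun _ => 0 := fun j => by
    funext z
    simp [partialD]
  have h0 : ∀ i j : Fin d, partialD i (partialD j (fun _ : 𝔼 d => r)) y = 0 := fun i j => by
    rw [h j]
    simp [partialD]
  simp [ellipticOp, h0]

theorem continuousAt_ellipticOp {a : (𝔼 d) → Matrix (Fin d) (Fin d) ℝ} {b : (𝔼 d) → 𝔼 d}
    {φ : (𝔼 d) → ℝ} {y : 𝔼 d} (ha : ContinuousAt a y) (hb : ContinuousAt b y)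
    (hφ : ContDiffAt ℝ 2 φ y) : ContinuousAt (ellipticOp a b φ) y := by
  have h1 : ContDiffAt ℝ 1 (fderiv ℝ φ) y := hφ.fderiv_right (m := 1) (by norm_num)
  have h2 : ContinuousAt (fderiv ℝ (fderiv ℝ φ)) y :=
    (h1.fderiv_right (m := 0) (by norm_num)).continuousAt
  have h3 : ∀ i j : Fin d, ContinuousAt (partialD i (partialD j φ)) y := by
    intro i j
    have : (fun z => fderiv ℝ (fderiv ℝ φ) z (EuclideanSpace.single i 1)
        (EuclideanSpace.single j 1)) =ᶠ[𝓝 y] partialD i (partialD j φ) := by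
      filter_upwards [hφ.eventually (by simp)] with z hz
      exact (partialD_partialD hz i j).symm
    refine ContinuousAt.congr ?_ this
    exact (h2.clm_apply continuousAt_const).clm_apply continuousAt_const
  have h4 : ContinuousAt (fun z => fderiv ℝ φ z (b z)) y := h1.continuousAt.clm_apply hb
  refine ContinuousAt.add ?_ h4
  refine tendsto_finsetSum _ fun i _ => tendsto_finsetSum _ fun j _ => ?_
  exact ((continuous_id.matrix_elem i j).continuousAt.comp ha).mul (h3 i j)

end EllipticOp

section Geometry

variable {d : ℕ} {M : Type*} [TopologicalSpace M]
  [ChartedSpace (EuclideanSpace ℝ (Fin d)) M] [IsManifold (𝓡 d) ∞ M]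

local notation "𝔼" d => EuclideanSpace ℝ (Fin d)

attribute [local instance] modelChartedSpace

/-- The first order coefficient of `Δ_g + ⟨X, ∇·⟩` in the chart `e`. -/
def driftInChart (g : SmoothMetric d M) (X : ∀ x : M, TangentSpace (𝓡 d) x)
    (e : OpenPartialHomeomorph M (𝔼 d)) (y : 𝔼 d) : 𝔼 d :=
  fieldInChart X e y - ∑ i, ∑ j, (g.coordMatrix e y)⁻¹ i j •
    ∑ k, g.christoffel e k i j y • EuclideanSpace.single k (1 : ℝ)

/-- Coordinate invariance replaces the chart at `x`, which moves with `x`, by the fixed chart at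
`x₀`. The Christoffel terms are of first order and are absorbed into the drift. -/
theorem driftLaplacian_eq_ellipticOp (g : SmoothMetric d M) (X : ∀ x : M, TangentSpace (𝓡 d) x)
    (x₀ : M) {φ : M → ℝ} {x : M} (hx : x ∈ (chartAt (𝔼 d) x₀).source)
    (hφ : ContMDiffAt (𝓡 d) 𝓘(ℝ, ℝ) 2 φ x) :
    driftLaplacian g X φ x = ellipticOp (fun y => (g.coordMatrix (chartAt (𝔼 d) x₀) y)⁻¹)
      (driftInChart g X (chartAt (𝔼 d) x₀)) (φ ∘ (chartAt (𝔼 d) x₀).symm)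
      (chartAt (𝔼 d) x₀ x) := by
  rw [driftLaplacian, SmoothMetric.laplacian, inner_gradient_eq_fderiv g X x₀ hx hφ,
    laplacianInChart_eq g x x₀ (mem_chart_source _ x) hx hφ]
  simp only [SmoothMetric.laplacianInChart, ellipticOp, driftInChart, map_sub, map_sum, map_smul,
    smul_eq_mul, mul_sub, Finset.sum_sub_distrib, partialD]
  ring

theorem continuousOn_coordMatrix (g : SmoothMetric d M) (x₀ : M) :
    ContinuousOn (g.coordMatrix (chartAt (𝔼 d) x₀)) (chartAt (𝔼 d) x₀).target := by
  refine continuousOn_pi.2 fun i => continuousOn_pi.2 fun j => ?_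
  exact ((contDiffOn_metricForm g x₀).continuousOn.clm_apply continuousOn_const).clm_apply
    continuousOn_const

theorem continuousOn_coordMatrix_inv (g : SmoothMetric d M) (x₀ : M) :
    ContinuousOn (fun y => (g.coordMatrix (chartAt (𝔼 d) x₀) y)⁻¹)
      (chartAt (𝔼 d) x₀).target := by
  intro y hy
  have hdet : (g.coordMatrix (chartAt (𝔼 d) x₀) y).det ≠ 0 :=
    (posDef_coordMatrix g x₀ hy).det_pos.ne'
  refine ContinuousAt.comp_continuousWithinAt
    (continuousAt_matrix_inv _ ?_) (continuousOn_coordMatrix g x₀ y hy)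
  rw [Ring.inverse_eq_inv']
  exact continuousAt_inv₀ hdet

theorem contDiffOn_coordMatrix_apply (g : SmoothMetric d M) (x₀ : M) (i j : Fin d) :
    ContDiffOn ℝ ∞ (fun y => g.coordMatrix (chartAt (𝔼 d) x₀) y i j)
      (chartAt (𝔼 d) x₀).target :=
  ((contDiffOn_metricForm g x₀).clm_apply contDiffOn_const).clm_apply contDiffOn_const

theorem continuousOn_christoffel (g : SmoothMetric d M) (x₀ : M) (k i j : Fin d) :
    ContinuousOn (g.christoffel (chartAt (𝔼 d) x₀) k i j) (chartAt (𝔼 d) x₀).target := by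
  have hp : ∀ l i j : Fin d, ContinuousOn
      (partialD l fun z => g.coordMatrix (chartAt (𝔼 d) x₀) z i j) (chartAt (𝔼 d) x₀).target :=
    fun l i j => ((contDiffOn_coordMatrix_apply g x₀ i j).continuousOn_fderiv_of_isOpen
      (chartAt (𝔼 d) x₀).open_target (by simp)).clm_apply continuousOn_const
  refine continuousOn_const.mul (continuousOn_finsetSum _ fun l _ => ContinuousOn.mul ?_
    (((hp _ _ _).add (hp _ _ _)).sub (hp _ _ _)))
  exact (continuous_id.matrix_elem k l).comp_continuousOn (continuousOn_coordMatrix_inv g x₀)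

theorem continuousOn_driftInChart (g : SmoothMetric d M) {X : ∀ x : M, TangentSpace (𝓡 d) x}
    (hX : Continuous fun x => (⟨x, X x⟩ : TangentBundle (𝓡 d) M)) (x₀ : M) :
    ContinuousOn (driftInChart g X (chartAt (𝔼 d) x₀)) (chartAt (𝔼 d) x₀).target := by
  refine (continuousOn_fieldInChart hX x₀).sub (continuousOn_finsetSum _ fun i _ =>
    continuousOn_finsetSum _ fun j _ => ContinuousOn.fun_smul ?_
      (continuousOn_finsetSum _ fun k _ =>
        (continuousOn_christoffel g x₀ k i j).fun_smul continuousOn_const))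
  exact (continuous_id.matrix_elem i j).comp_continuousOn (continuousOn_coordMatrix_inv g x₀)

theorem contDiffAt_comp_chart_symm_apply (x₀ : M) {φ : M → ℝ} {x : M}
    (hx : x ∈ (chartAt (𝔼 d) x₀).source) (hφ : ContMDiffAt (𝓡 d) 𝓘(ℝ, ℝ) 2 φ x) :
    ContDiffAt ℝ 2 (φ ∘ (chartAt (𝔼 d) x₀).symm) (chartAt (𝔼 d) x₀ x) :=
  contDiffAt_comp_chart_symm two_le_infty x₀ ((chartAt (𝔼 d) x₀).map_source hx)
    (by rwa [(chartAt (𝔼 d) x₀).left_inv hx])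

/-- The system holds only off the union of all the poles, yet a component is `C²` at the poles of
the others. Continuity carries differential inequalities to those points. -/
theorem continuousAt_driftLaplacian (g : SmoothMetric d M) {X : ∀ x : M, TangentSpace (𝓡 d) x}
    (hX : Continuous fun x => (⟨x, X x⟩ : TangentBundle (𝓡 d) M)) {φ : M → ℝ} {x : M}
    (hφ : ContMDiffAt (𝓡 d) 𝓘(ℝ, ℝ) 2 φ x) : ContinuousAt (driftLaplacian g X φ) x := by
  have : IsManifold (𝓡 d) 2 M := .of_le (n := ∞) two_le_infty
  set e := chartAt (𝔼 d) x with he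
  have hx : x ∈ e.source := mem_chart_source _ x
  have hy : e.target ∈ 𝓝 (e x) := e.open_target.mem_nhds (e.map_source hx)
  have h1 := continuousAt_ellipticOp ((continuousOn_coordMatrix_inv g x).continuousAt hy)
    ((continuousOn_driftInChart g hX x).continuousAt hy) (contDiffAt_comp_chart_symm_apply x hx hφ)
  refine (ContinuousAt.comp h1 (e.continuousAt hx)).congr ?_
  filter_upwards [(contMDiffAt_iff_contMDiffAt_nhds (by simp)).1 hφ,
    e.open_source.mem_nhds hx] with z hz hze
  exact (driftLaplacian_eq_ellipticOp g X x hze hz).symm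

theorem driftLaplacian_const (g : SmoothMetric d M) (X : ∀ x : M, TangentSpace (𝓡 d) x) (r : ℝ)
    (x : M) : driftLaplacian g X (fun _ => r) x = 0 := by
  rw [driftLaplacian_eq_ellipticOp g X x (mem_chart_source _ x) contMDiffAt_const]
  exact ellipticOp_const _ _ r _

theorem driftLaplacian_sub_smul (g : SmoothMetric d M) (X : ∀ x : M, TangentSpace (𝓡 d) x)
    {φ ψ : M → ℝ} {x : M} (hφ : ContMDiffAt (𝓡 d) 𝓘(ℝ, ℝ) 2 φ x)
    (hψ : ContMDiffAt (𝓡 d) 𝓘(ℝ, ℝ) 2 ψ x) (r : ℝ) :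
    driftLaplacian g X (fun z => φ z - r * ψ z) x =
      driftLaplacian g X φ x - r * driftLaplacian g X ψ x := by
  have hx := mem_chart_source (𝔼 d) x
  have h : ContMDiffAt (𝓡 d) 𝓘(ℝ, ℝ) 2 (fun z => φ z - r * ψ z) x :=
    hφ.sub (contMDiffAt_const.mul hψ)
  rw [driftLaplacian_eq_ellipticOp g X x hx hφ, driftLaplacian_eq_ellipticOp g X x hx hψ,
    driftLaplacian_eq_ellipticOp g X x hx h]
  exact ellipticOp_sub_smul (contDiffAt_comp_chart_symm_apply x hx hφ)
    (contDiffAt_comp_chart_symm_apply x hx hψ) r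

theorem driftLaplacian_sum (g : SmoothMetric d M) (X : ∀ x : M, TangentSpace (𝓡 d) x)
    {ι : Type*} [DecidableEq ι] {u : ι → M → ℝ} {x : M} (S : Finset ι)
    (hu : ∀ i ∈ S, ContMDiffAt (𝓡 d) 𝓘(ℝ, ℝ) 2 (u i) x) :
    driftLaplacian g X (fun z => ∑ i ∈ S, u i z) x = ∑ i ∈ S, driftLaplacian g X (u i) x := by
  induction S using Finset.induction_on with
  | empty => simpa using driftLaplacian_const g X 0 x
  | insert i S hi ih =>
    have hS := fun j hj => hu j (Finset.mem_insert_of_mem hj)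
    have h := driftLaplacian_sub_smul g X (hu i (Finset.mem_insert_self i S))
      (contMDiffAt_finsetSum (I' := 𝓡 d) hS) (-1)
    rw [Finset.sum_insert hi, ← ih hS]
    simp only [Finset.sum_insert hi]
    simpa using h

/-- Strong minimum principle on a connected manifold, for functions which at every point are
touched from above by a `C²` function `φ` with `Δ_g φ + ⟨X, ∇φ⟩ ≤ C (w - m)`. -/
theorem strong_minimum_principle [ConnectedSpace M] (g : SmoothMetric d M)
    {X : ∀ x : M, TangentSpace (𝓡 d) x}
    (hX : Continuous fun x => (⟨x, X x⟩ : TangentBundle (𝓡 d) M)) {w : M → ℝ} (hw : Continuous w)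
    {C m : ℝ} (hC : 0 ≤ C) (hm : ∀ x, m ≤ w x)
    (htouch : ∀ x, ∃ φ : M → ℝ, ContMDiffAt (𝓡 d) 𝓘(ℝ, ℝ) 2 φ x ∧ φ x = w x ∧
      (∀ᶠ y in 𝓝 x, w y ≤ φ y) ∧ driftLaplacian g X φ x ≤ C * (w x - m))
    {x₀ : M} (hx₀ : w x₀ = m) (x : M) : w x = m := by
  -- The minimum set is closed by continuity and open by the local principle in a chart;
  -- connectedness finishes the argument.
  have hclopen : IsClopen (w ⁻¹' {m}) := by
    refine ⟨isClosed_singleton.preimage hw, isOpen_iff_mem_nhds.2 fun z hz => ?_⟩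
    set e := chartAt (𝔼 d) z with he
    have hze : z ∈ e.source := mem_chart_source _ z
    have hsuper : IsTouchedSupersolution (fun y => (g.coordMatrix e y)⁻¹) (driftInChart g X e) C m
        (w ∘ e.symm) e.target := by
      intro y hy
      obtain ⟨φ, hφ, hφx, hφw, hL⟩ := htouch (e.symm y)
      refine ⟨φ ∘ e.symm, contDiffAt_comp_chart_symm two_le_infty z hy hφ, hφx,
        (e.continuousAt_symm hy).eventually hφw, ?_⟩
      rw [driftLaplacian_eq_ellipticOp g X z (e.map_target hy) hφ] at hL
      rw [← he, e.right_inv hy] at hL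
      exact hL
    have h1 := hsuper.eventually_eq hC e.open_target (continuousOn_coordMatrix_inv g z)
      (continuousOn_driftInChart g hX z) (fun y hy => (posDef_coordMatrix g z hy).inv)
      (hw.comp_continuousOn e.continuousOn_symm) (fun y _ => hm _) (e.map_source hze)
      (by simpa [e.left_inv hze] using hz)
    filter_upwards [(e.continuousAt hze).eventually h1, e.open_source.mem_nhds hze] with q hq hqe
    simpa [e.left_inv hqe] using hq
  have := hclopen.eq_univ ⟨x₀, hx₀⟩
  have hx : x ∈ w ⁻¹' {m} := this ▸ mem_univ x
  exact hx

end Geometry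
end

noncomputable section

/-! ### Truncations, and the topology of the pole sets. -/

section Truncation

variable {M : Type*}

open Classical in
/-- The truncation `min (u, r)` of a function equal to `+∞` on `S`. -/
def truncation (S : Set M) (r : ℝ) (u : M → ℝ) (x : M) : ℝ := if x ∈ S then r else min (u x) r

theorem truncation_of_notMem {S : Set M} {x : M} (hx : x ∉ S) (r : ℝ) (u : M → ℝ) :
    truncation S r u x = min (u x) r := if_neg hx

theorem truncation_of_mem {S : Set M} {x : M} (hx : x ∈ S) (r : ℝ) (u : M → ℝ) :
    truncation S r u x = r := if_pos hx

theorem truncation_le (S : Set M) (r : ℝ) (u : M → ℝ) (x : M) : truncation S r u x ≤ r := by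
  unfold truncation
  split_ifs <;> simp

end Truncation

section Poles

variable {M : Type*} [TopologicalSpace M]

/-- An open singleton would be carried by the chart to an open singleton of `ℝ^d`, impossible when
`d ≥ 1`. -/
theorem neBot_nhdsNE_of_chartedSpace {d : ℕ} (hd : 1 ≤ d)
    [ChartedSpace (EuclideanSpace ℝ (Fin d)) M] (x : M) : (𝓝[≠] x).NeBot := by
  rw [neBot_iff, Ne, ← isOpen_singleton_iff_punctured_nhds]
  intro h
  set e := chartAt (EuclideanSpace ℝ (Fin d)) x
  have hx : x ∈ e.source := mem_chart_source _ x
  have h1 : IsOpen (e '' {x}) := e.isOpen_image_of_subset_source h (by simpa using hx)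
  have : Nonempty (Fin d) := ⟨⟨0, hd⟩⟩
  rw [image_singleton, isOpen_singleton_iff_punctured_nhds] at h1
  exact (Module.punctured_nhds_neBot ℝ _ (e x)).ne h1

/-- A discrete set along which a function continuous on the complement blows up is closed. -/
theorem isClosed_of_isDiscrete_of_tendsto_atTop (hperf : ∀ x : M, (𝓝[≠] x).NeBot) {S : Set M}
    (hS : IsDiscrete S) {u : M → ℝ} (hu : ContinuousOn u Sᶜ)
    (hpole : ∀ p ∈ S, Tendsto u (𝓝[Sᶜ] p) atTop) : IsClosed S := by
  rw [← isOpen_compl_iff, isOpen_iff_mem_nhds]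
  intro q hq
  -- Off `S`, `u` is bounded above near `q`. A pole `p` near `q` would be approached by points off
  -- `S`, as `S` is discrete and `p` is not isolated in `M`, and `u` would be arbitrarily large at
  -- them.
  have h1 : ∀ᶠ x in 𝓝[Sᶜ] q, u x < u q + 1 := (hu q hq).eventually_lt_const (by linarith)
  rw [eventually_nhdsWithin_iff] at h1
  obtain ⟨V, hV, hVo, hqV⟩ := eventually_nhds_iff.1 h1
  refine mem_of_superset (hVo.mem_nhds hqV) fun p hpV hpS => ?_
  have hle : 𝓝[≠] p ≤ 𝓝[Sᶜ] p := by
    refine le_inf inf_le_left (le_principal_iff.2 ?_)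
    have := isDiscrete_iff_nhdsNE.1 hS p hpS
    rwa [inf_principal_eq_bot] at this
  have := hperf p
  have hne : (𝓝[Sᶜ] p).NeBot := neBot_of_le hle
  obtain ⟨x, hx1, hx2, hx3⟩ := (((hpole p hpS).eventually_gt_atTop (u q + 1)).and
    (((hVo.eventually_mem hpV).filter_mono nhdsWithin_le_nhds).and self_mem_nhdsWithin)).exists
  exact lt_asymm hx1 (hV x hx2 hx3)

theorem continuous_truncation {S : Set M} (hS : IsClosed S) (r : ℝ) {u : M → ℝ}
    (hu : ∀ x ∉ S, ContinuousAt u x) (hpole : ∀ p ∈ S, Tendsto u (𝓝[Sᶜ] p) atTop) :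
    Continuous (truncation S r u) := by
  rw [continuous_iff_continuousAt]
  intro x
  by_cases hx : x ∈ S
  · have h1 := (hpole x hx).eventually_ge_atTop r
    rw [eventually_nhdsWithin_iff] at h1
    refine (continuousAt_const (y := r)).congr ?_
    filter_upwards [h1] with z hz
    by_cases hzS : z ∈ S
    · rw [truncation_of_mem hzS]
    · rw [truncation_of_notMem hzS, min_eq_right (hz hzS)]
  · have hmin : ContinuousAt (fun z => min (u z) r) x := (hu x hx).min tendsto_const_nhds
    refine hmin.congr ?_
    filter_upwards [hS.isOpen_compl.mem_nhds hx] with z hz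
    rw [truncation_of_notMem hz]

end Poles

/-! ### Pointwise inequalities for cooperative, column dominant matrices. -/

section Algebra

variable {ι : Type*} [Fintype ι]

theorem sum_sub_sum_mul (S : Finset ι) (c : ι → ι → ℝ) (u f : ι → ℝ) :
    ∑ i ∈ S, (f i - ∑ j, c i j * u j) = ∑ i ∈ S, f i - ∑ j, (∑ i ∈ S, c i j) * u j := by
  rw [Finset.sum_sub_distrib, Finset.sum_comm]
  simp only [Finset.sum_mul]

variable [DecidableEq ι]

/-- The entries left out of the column are off-diagonal because `j ∈ S`, hence nonnegative. -/
theorem sum_column_nonpos {c : ι → ι → ℝ} (hcoop : ∀ i j, i ≠ j → 0 ≤ c i j)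
    (hcol : ∀ j, ∑ i, c i j ≤ 0) (S : Finset ι) {j : ι} (hj : j ∈ S) :
    ∑ i ∈ S, c i j ≤ 0 := by
  have h1 := Finset.sum_add_sum_compl S (fun i => c i j)
  have h2 : 0 ≤ ∑ i ∈ Sᶜ, c i j := Finset.sum_nonneg fun i hi => hcoop i j (by
    rintro rfl
    exact Finset.mem_compl.1 hi hj)
  linarith [hcol j]

/-- For `j ∈ S` a nonpositive partial column sum multiplies `u j ≤ 0`, with a favourable sign. For
`j ∉ S` the partial sum is off-diagonal, so it lies between `0` and `card ι * C`, and only the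
negative part of `u j` costs anything. -/
theorem sum_sub_sum_mul_le {c : ι → ι → ℝ} {u f : ι → ℝ} {C : ℝ}
    (hcoop : ∀ i j, i ≠ j → 0 ≤ c i j) (hcol : ∀ j, ∑ i, c i j ≤ 0) (hC : ∀ i j, |c i j| ≤ C)
    (hf : ∀ i, f i ≤ 0) (S : Finset ι) (hS : ∀ j ∈ S, u j ≤ 0) :
    ∑ i ∈ S, (f i - ∑ j, c i j * u j) ≤
      (Fintype.card ι * C) * ∑ j ∈ Sᶜ, -min (u j) 0 := by
  rw [sum_sub_sum_mul, ← Finset.sum_add_sum_compl S (fun j => (∑ i ∈ S, c i j) * u j)]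
  have h1 : ∑ i ∈ S, f i ≤ 0 := Finset.sum_nonpos fun i _ => hf i
  have h2 : 0 ≤ ∑ j ∈ S, (∑ i ∈ S, c i j) * u j := Finset.sum_nonneg fun j hj =>
    mul_nonneg_of_nonpos_of_nonpos (sum_column_nonpos hcoop hcol S hj) (hS j hj)
  have h3 : -∑ j ∈ Sᶜ, (∑ i ∈ S, c i j) * u j ≤
      (Fintype.card ι * C) * ∑ j ∈ Sᶜ, -min (u j) 0 := by
    rw [← Finset.sum_neg_distrib, Finset.mul_sum]
    refine Finset.sum_le_sum fun j hj => ?_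
    have hs0 : 0 ≤ ∑ i ∈ S, c i j := Finset.sum_nonneg fun i hi => hcoop i j (by
      rintro rfl
      exact Finset.mem_compl.1 hj hi)
    have hsC : ∑ i ∈ S, c i j ≤ Fintype.card ι * C := by
      have hC0 : 0 ≤ C := (abs_nonneg _).trans (hC j j)
      calc ∑ i ∈ S, c i j ≤ ∑ i ∈ S, C :=
            Finset.sum_le_sum fun i _ => (le_abs_self _).trans (hC i j)
        _ = S.card * C := by simp
        _ ≤ Fintype.card ι * C := by
          gcongr
          exact Finset.card_le_univ S
    have h4 : 0 ≤ -min (u j) 0 := by simp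
    have h5 : (∑ i ∈ S, c i j) * min (u j) 0 ≤ (∑ i ∈ S, c i j) * u j :=
      mul_le_mul_of_nonneg_left (min_le_left _ _) hs0
    have h6 := mul_le_mul_of_nonneg_right hsC h4
    linarith
  linarith

/-- Every term has a sign, so each vanishes. For `j ∈ S` the column sum over `S` is then zero, and
column dominance leaves no room for the nonnegative entries outside `S`. -/
theorem eq_zero_of_sum_sub_sum_mul_eq_zero {c : ι → ι → ℝ} {u f : ι → ℝ}
    (hcoop : ∀ i j, i ≠ j → 0 ≤ c i j) (hcol : ∀ j, ∑ i, c i j ≤ 0)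
    (hf : ∀ i, f i ≤ 0) (S : Finset ι) (hS : ∀ j ∈ S, u j < 0) (hS' : ∀ j ∉ S, 0 ≤ u j)
    (h0 : ∑ i ∈ S, (f i - ∑ j, c i j * u j) = 0) :
    (∀ i ∈ S, f i = 0) ∧ ∀ i ∉ S, ∀ j ∈ S, c i j = 0 := by
  rw [sum_sub_sum_mul] at h0
  have h1 : ∑ i ∈ S, f i ≤ 0 := Finset.sum_nonpos fun i _ => hf i
  have h2 : ∀ j ∈ Finset.univ, 0 ≤ (∑ i ∈ S, c i j) * u j := fun j _ => by
    by_cases hj : j ∈ S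
    · exact mul_nonneg_of_nonpos_of_nonpos (sum_column_nonpos hcoop hcol S hj) (hS j hj).le
    · exact mul_nonneg (Finset.sum_nonneg fun i hi => hcoop i j (by rintro rfl; exact hj hi))
        (hS' j hj)
  have h3 := Finset.sum_nonneg h2
  have h4 : ∑ j, (∑ i ∈ S, c i j) * u j = 0 := by linarith
  have h5 : ∑ i ∈ S, f i = 0 := by linarith
  refine ⟨(Finset.sum_eq_zero_iff_of_nonpos fun i _ => hf i).1 h5, fun i hi j hj => ?_⟩
  have h6 := (Finset.sum_eq_zero_iff_of_nonneg h2).1 h4 j (Finset.mem_univ j)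
  have h7 : ∑ i ∈ S, c i j = 0 := (mul_eq_zero.1 h6).resolve_right (hS j hj).ne
  have h8 := Finset.sum_add_sum_compl S (fun i => c i j)
  have h9 : ∀ i ∈ Sᶜ, 0 ≤ c i j := fun i hi => hcoop i j (by
    rintro rfl
    exact Finset.mem_compl.1 hi hj)
  have h10 : ∑ i ∈ Sᶜ, c i j = 0 :=
    le_antisymm (by linarith [hcol j]) (Finset.sum_nonneg h9)
  exact (Finset.sum_eq_zero_iff_of_nonneg h9).1 h10 i (Finset.mem_compl.2 hi)

end Algebra
end

noncomputable section

/-! ### The maximum principle for the system. -/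

section System

variable {d : ℕ} {M : Type*} [TopologicalSpace M]
  [ChartedSpace (EuclideanSpace ℝ (Fin d)) M] [IsManifold (𝓡 d) ∞ M]

/-- A cooperative, column diagonally dominant system `Δ_g u + ⟨X, ∇u⟩ + c u = f ≤ 0` outside
finitely many poles, with coefficients bounded by `C`. -/
structure IsCooperativeSystem (g : SmoothMetric d M) (X : ∀ x : M, TangentSpace (𝓡 d) x) {n : ℕ}
    (Pole : Fin n → Set M) (u : Fin n → M → ℝ) (c : Fin n → Fin n → M → ℝ) (f : Fin n → M → ℝ)
    (C : ℝ) : Prop where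
  finite_pole : ∀ i, (Pole i).Finite
  contMDiffAt : ∀ i, ∀ x ∉ Pole i, ContMDiffAt (𝓡 d) 𝓘(ℝ, ℝ) 2 (u i) x
  tendsto_pole : ∀ i, ∀ p ∈ Pole i, Tendsto (u i) (𝓝[(Pole i)ᶜ] p) atTop
  bound_nonneg : 0 ≤ C
  bound : ∀ x ∉ ⋃ i, Pole i, ∀ i j, |c i j x| ≤ C
  coop : ∀ x ∉ ⋃ i, Pole i, ∀ i j, i ≠ j → 0 ≤ c i j x
  col : ∀ x ∉ ⋃ i, Pole i, ∀ j, ∑ i, c i j x ≤ 0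
  nonpos : ∀ x ∉ ⋃ i, Pole i, ∀ i, f i x ≤ 0
  eqn : ∀ x ∉ ⋃ i, Pole i, ∀ i, driftLaplacian g X (u i) x = f i x - ∑ j, c i j x * u j x

namespace IsCooperativeSystem

variable {g : SmoothMetric d M} {X : ∀ x : M, TangentSpace (𝓡 d) x} {n : ℕ}
  {Pole : Fin n → Set M} {u : Fin n → M → ℝ} {c : Fin n → Fin n → M → ℝ} {f : Fin n → M → ℝ}
  {C : ℝ}

theorem continuous_truncation [T2Space M] (h : IsCooperativeSystem g X Pole u c f C) (i : Fin n)
    (r : ℝ) : Continuous (truncation (Pole i) r (u i)) :=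
  _root_.continuous_truncation (h.finite_pole i).isClosed r
    (fun x hx => (h.contMDiffAt i x hx).continuousAt) (h.tendsto_pole i)

theorem neBot_nhdsWithin_compl [T2Space M] (h : IsCooperativeSystem g X Pole u c f C)
    (hd : 1 ≤ d) (x : M) : (𝓝[(⋃ i, Pole i)ᶜ] x).NeBot := by
  have := fun x : M => neBot_nhdsNE_of_chartedSpace hd x
  have hfin : (⋃ i, Pole i).Finite := finite_iUnion h.finite_pole
  have hdense : Dense (univ \ ⋃ i, Pole i) := dense_univ.sdiff_finite hfin
  rw [← compl_eq_univ_sdiff] at hdense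
  exact mem_closure_iff_nhdsWithin_neBot.1 (hdense x)

theorem driftLaplacian_sum_le [T2Space M] (h : IsCooperativeSystem g X Pole u c f C) (hd : 1 ≤ d)
    (hX : Continuous fun x => (⟨x, X x⟩ : TangentBundle (𝓡 d) M)) (S : Finset (Fin n)) {x : M}
    (hS : ∀ j ∈ S, x ∉ Pole j ∧ u j x < 0) :
    driftLaplacian g X (fun z => ∑ j ∈ S, u j z) x ≤
      (n * C) * ∑ j ∈ Sᶜ, -truncation (Pole j) 0 (u j) x := by
  have hne := h.neBot_nhdsWithin_compl hd x
  have hC2 : ContMDiffAt (𝓡 d) 𝓘(ℝ, ℝ) 2 (fun z => ∑ j ∈ S, u j z) x :=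
    contMDiffAt_finsetSum (I' := 𝓡 d) fun j hj => h.contMDiffAt j x (hS j hj).1
  have hl : Tendsto (driftLaplacian g X (fun z => ∑ j ∈ S, u j z)) (𝓝[(⋃ i, Pole i)ᶜ] x)
      (𝓝 (driftLaplacian g X (fun z => ∑ j ∈ S, u j z) x)) :=
    (continuousAt_driftLaplacian g hX hC2).tendsto.mono_left nhdsWithin_le_nhds
  have hr : Tendsto (fun z => (n * C) * ∑ j ∈ Sᶜ, -truncation (Pole j) 0 (u j) z)
      (𝓝[(⋃ i, Pole i)ᶜ] x) (𝓝 ((n * C) * ∑ j ∈ Sᶜ, -truncation (Pole j) 0 (u j) x)) := by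
    have : Continuous fun z => (n * C) * ∑ j ∈ Sᶜ, -truncation (Pole j) 0 (u j) z :=
      continuous_const.mul (continuous_finsetSum _ fun j _ => (h.continuous_truncation j 0).neg)
    exact this.continuousAt.tendsto.mono_left nhdsWithin_le_nhds
  -- The point `x` may be a pole of a component outside `S`. Both sides are continuous at `x`, so it
  -- suffices to compare them on the complement of the poles, which accumulates at `x`.
  refine le_of_tendsto_of_tendsto hl hr ?_
  have hneg : ∀ᶠ z in 𝓝 x, ∀ j ∈ S, u j z < 0 :=
    (Finset.eventually_all S).2 fun j hj =>
      (h.contMDiffAt j x (hS j hj).1).continuousAt.eventually_lt_const (hS j hj).2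
  filter_upwards [hneg.filter_mono nhdsWithin_le_nhds, self_mem_nhdsWithin] with z hz hzP
  have hzj : ∀ j, z ∉ Pole j := fun j hj => hzP (mem_iUnion.2 ⟨j, hj⟩)
  rw [driftLaplacian_sum g X S fun j _ => h.contMDiffAt j z (hzj j)]
  simp only [h.eqn z hzP]
  have := sum_sub_sum_mul_le (h.coop z hzP) (h.col z hzP) (h.bound z hzP) (h.nonpos z hzP) S
    (fun j hj => (hz j hj).le) (u := fun j => u j z)
  rw [Fintype.card_fin] at this
  simpa only [truncation_of_notMem (hzj _)] using this

open Classical in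
/-- Partial sums of the negative parts are touched from above by sums of components. -/
theorem exists_touching [T2Space M] (h : IsCooperativeSystem g X Pole u c f C) (hd : 1 ≤ d)
    (hX : Continuous fun x => (⟨x, X x⟩ : TangentBundle (𝓡 d) M)) (T : Finset (Fin n)) (x : M) :
    ∃ φ : M → ℝ, ContMDiffAt (𝓡 d) 𝓘(ℝ, ℝ) 2 φ x ∧
      φ x = ∑ j ∈ T, truncation (Pole j) 0 (u j) x ∧
      (∀ᶠ y in 𝓝 x, ∑ j ∈ T, truncation (Pole j) 0 (u j) y ≤ φ y) ∧
      driftLaplacian g X φ x ≤ (n * C) * ∑ j ∈ Tᶜ, -truncation (Pole j) 0 (u j) x := by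
  -- Only the strictly negative components are kept. The discarded truncations vanish at `x` and are
  -- nonpositive everywhere, so dropping them leaves the value at `x` unchanged and can only raise
  -- the function nearby.
  set S := T.filter fun j => x ∉ Pole j ∧ u j x < 0 with hSdef
  have hS : ∀ j ∈ S, x ∉ Pole j ∧ u j x < 0 := fun j hj => (Finset.mem_filter.1 hj).2
  have hST : S ⊆ T := Finset.filter_subset _ _
  have hzero : ∀ j ∈ T, j ∉ S → truncation (Pole j) 0 (u j) x = 0 := by
    intro j hjT hjS
    by_cases hx : x ∈ Pole j
    · exact truncation_of_mem hx _ _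
    · rw [truncation_of_notMem hx]
      refine min_eq_right ?_
      by_contra! hlt
      exact hjS (Finset.mem_filter.2 ⟨hjT, hx, hlt⟩)
  refine ⟨fun z => ∑ j ∈ S, u j z, ?_, ?_, ?_, ?_⟩
  · exact contMDiffAt_finsetSum (I' := 𝓡 d) fun j hj => h.contMDiffAt j x (hS j hj).1
  · rw [← Finset.sum_subset hST hzero]
    refine Finset.sum_congr rfl fun j hj => ?_
    rw [truncation_of_notMem (hS j hj).1, min_eq_left (hS j hj).2.le]
  · have hpole : ∀ᶠ y in 𝓝 x, ∀ j ∈ S, y ∉ Pole j :=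
      (Finset.eventually_all S).2 fun j hj =>
        (h.finite_pole j).isClosed.isOpen_compl.mem_nhds (hS j hj).1
    filter_upwards [hpole] with y hy
    calc ∑ j ∈ T, truncation (Pole j) 0 (u j) y ≤ ∑ j ∈ S, truncation (Pole j) 0 (u j) y := by
          rw [← Finset.sum_sdiff hST]
          exact add_le_of_nonpos_left (Finset.sum_nonpos fun j _ => truncation_le _ _ _ _)
      _ ≤ ∑ j ∈ S, u j y := Finset.sum_le_sum fun j hj => by
          rw [truncation_of_notMem (hy j hj)]
          exact min_le_left _ _
  · refine (h.driftLaplacian_sum_le hd hX S hS).trans (le_of_eq ?_)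
    congr 1
    refine (Finset.sum_subset (Finset.compl_subset_compl.2 hST) fun j hj hjT => ?_).symm
    rw [hzero j (by simpa using hjT) (by simpa using hj), neg_zero]

/-- The sum of the negative parts is constant. -/
theorem exists_sum_truncation_eq [T2Space M] [CompactSpace M] [ConnectedSpace M]
    (h : IsCooperativeSystem g X Pole u c f C) (hd : 1 ≤ d)
    (hX : Continuous fun x => (⟨x, X x⟩ : TangentBundle (𝓡 d) M)) :
    ∃ m : ℝ, ∀ x, ∑ j, truncation (Pole j) 0 (u j) x = m := by
  have hcont : Continuous fun x => ∑ j, truncation (Pole j) 0 (u j) x :=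
    continuous_finsetSum _ fun j _ => h.continuous_truncation j 0
  obtain ⟨x₀, -, hmin⟩ := isCompact_univ.exists_isMinOn univ_nonempty hcont.continuousOn
  -- For the full index set the complement is empty and the upper bound is `0`, so `le_rfl` chooses
  -- the zeroth order constant `C = 0`.
  refine ⟨_, fun x => strong_minimum_principle g hX hcont le_rfl (fun x => hmin (mem_univ x))
    (fun x => ?_) (x₀ := x₀) rfl x⟩
  obtain ⟨φ, h1, h2, h3, h4⟩ := h.exists_touching hd hX Finset.univ x
  exact ⟨φ, h1, h2, h3, by simpa using h4⟩

/-- If the sum of the negative parts is constant, each of them vanishes identically or nowhere. -/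
theorem truncation_eq_zero_or_neg [T2Space M] [ConnectedSpace M]
    (h : IsCooperativeSystem g X Pole u c f C) (hd : 1 ≤ d)
    (hX : Continuous fun x => (⟨x, X x⟩ : TangentBundle (𝓡 d) M)) {m : ℝ}
    (hm : ∀ x, ∑ j, truncation (Pole j) 0 (u j) x = m) (i : Fin n) :
    (∀ x, truncation (Pole i) 0 (u i) x = 0) ∨ ∀ x, truncation (Pole i) 0 (u i) x < 0 := by
  by_contra! hcon
  obtain ⟨⟨x₁, hx₁⟩, x₀, hx₀⟩ := hcon
  have hx₀' := le_antisymm (truncation_le _ _ _ _) hx₀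
  -- The excess of this partial sum over `m` is exactly minus the truncation of `u i`, which is also
  -- what `exists_touching` puts on its right-hand side. The strong minimum principle thus applies
  -- with constant `n * C`, the minimum being attained at `x₀`.
  have hsum : ∀ x, ∑ j ∈ {i}ᶜ, truncation (Pole j) 0 (u j) x =
      m - truncation (Pole i) 0 (u i) x := fun x => by
    rw [← hm x, ← Finset.sum_compl_add_sum {i}]
    simp
  refine hx₁ ?_
  have hnC : 0 ≤ n * C := mul_nonneg (Nat.cast_nonneg n) h.bound_nonneg
  have := strong_minimum_principle g hX (m := m) (C := n * C)
    (w := fun x => ∑ j ∈ {i}ᶜ, truncation (Pole j) 0 (u j) x)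
    (continuous_finsetSum _ fun j _ => h.continuous_truncation j 0) hnC
    (fun x => by rw [hsum]; linarith [truncation_le (Pole i) 0 (u i) x]) (fun x => ?_)
    (x₀ := x₀) (by rw [hsum, hx₀', sub_zero]) x₁
  · rw [hsum] at this
    linarith
  · obtain ⟨φ, h1, h2, h3, h4⟩ := h.exists_touching hd hX {i}ᶜ x
    refine ⟨φ, h1, h2, h3, h4.trans (le_of_eq ?_)⟩
    rw [hsum]
    simp

/-- A nonnegative component vanishes identically or is positive. -/
theorem pos_or_eq_zero [T2Space M] [ConnectedSpace M]
    (h : IsCooperativeSystem g X Pole u c f C) (hd : 1 ≤ d)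
    (hX : Continuous fun x => (⟨x, X x⟩ : TangentBundle (𝓡 d) M))
    (hnn : ∀ j, ∀ x ∉ Pole j, 0 ≤ u j x) (i : Fin n) :
    (∀ x ∉ Pole i, 0 < u i x) ∨ (Pole i = ∅ ∧ ∀ x, u i x = 0) := by
  by_contra! hcon
  obtain ⟨⟨x₀, hx₀, hle⟩, hcon⟩ := hcon
  have hu₀ : u i x₀ = 0 := le_antisymm hle (hnn i x₀ hx₀)
  -- Truncating at the positive level `1` makes the value at a pole nonzero, so identical vanishing
  -- also excludes poles. Where the truncation equals `1`, the constant `1` touches it from above;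
  -- elsewhere `u i` itself does.
  have key := strong_minimum_principle g hX (m := 0) (C := C) (h.continuous_truncation i 1)
    h.bound_nonneg (fun x => ?_) (fun x => ?_) (x₀ := x₀)
    (by rw [truncation_of_notMem hx₀, hu₀]; simp)
  · have hempty : Pole i = ∅ := by
      refine eq_empty_of_forall_notMem fun p hp => ?_
      have := key p
      rw [truncation_of_mem hp] at this
      exact one_ne_zero this
    obtain ⟨x, hx⟩ := hcon hempty
    have h1 := key x
    rw [truncation_of_notMem (by simp [hempty])] at h1
    rcases min_choice (u i x) 1 with h2 | h2
    · exact hx (h2 ▸ h1)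
    · exact one_ne_zero (h2 ▸ h1)
  · by_cases hx : x ∈ Pole i
    · rw [truncation_of_mem hx]
      exact zero_le_one
    · rw [truncation_of_notMem hx]
      exact le_min (hnn i x hx) zero_le_one
  · by_cases hx : x ∈ Pole i ∨ 1 ≤ u i x
    · have h1 : truncation (Pole i) 1 (u i) x = 1 := by
        by_cases hxP : x ∈ Pole i
        · exact truncation_of_mem hxP _ _
        · rw [truncation_of_notMem hxP, min_eq_right (hx.resolve_left hxP)]
      refine ⟨fun _ => 1, contMDiffAt_const, h1.symm,
        Eventually.of_forall fun y => truncation_le _ _ _ _, ?_⟩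
      rw [driftLaplacian_const, h1]
      simpa using h.bound_nonneg
    · push Not at hx
      have hne := h.neBot_nhdsWithin_compl hd x
      have hC2 := h.contMDiffAt i x hx.1
      have h1 : truncation (Pole i) 1 (u i) x = u i x := by
        rw [truncation_of_notMem hx.1, min_eq_left hx.2.le]
      refine ⟨u i, hC2, h1.symm, ?_, ?_⟩
      · filter_upwards [(h.finite_pole i).isClosed.isOpen_compl.mem_nhds hx.1] with y hy
        rw [truncation_of_notMem hy]
        exact min_le_left _ _
      · rw [h1, sub_zero]
        refine le_of_tendsto_of_tendsto
          ((continuousAt_driftLaplacian g hX hC2).tendsto.mono_left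
            (nhdsWithin_le_nhds (s := (⋃ i, Pole i)ᶜ)))
          ((hC2.continuousAt.const_mul C).tendsto.mono_left nhdsWithin_le_nhds) ?_
        filter_upwards [self_mem_nhdsWithin] with z hzP
        have hzj : ∀ j, z ∉ Pole j := fun j hj => hzP (mem_iUnion.2 ⟨j, hj⟩)
        -- The off-diagonal terms and `f i` have favourable signs, leaving `L u_i ≤ -c_ii u_i ≤ C
        -- u_i`.
        rw [h.eqn z hzP, ← Finset.add_sum_erase _ _ (Finset.mem_univ i)]
        have h2 : 0 ≤ ∑ j ∈ Finset.univ.erase i, c i j z * u j z :=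
          Finset.sum_nonneg fun j hj => mul_nonneg
            (h.coop z hzP i j (Finset.ne_of_mem_erase hj).symm) (hnn j z (hzj j))
        have h3 := h.nonpos z hzP i
        have h4 := mul_le_mul_of_nonneg_right ((neg_le_abs _).trans (h.bound z hzP i i))
          (hnn i z (hzj i))
        linarith

/-- For an identically vanishing component `i`, the equation reads `∑ c_ij u_j = f_i ≤ 0` with
nonnegative terms on the left, so `c_ij = 0` whenever `u_j > 0`. A mixture of vanishing and positive
components would therefore contradict full coupling. -/
theorem pos_or_eq_zero_of_nonneg [T2Space M] [ConnectedSpace M]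
    (h : IsCooperativeSystem g X Pole u c f C) (hd : 1 ≤ d)
    (hX : Continuous fun x => (⟨x, X x⟩ : TangentBundle (𝓡 d) M))
    (hfull : FullyCoupled c (⋃ i, Pole i)ᶜ) (hnn : ∀ j, ∀ x ∉ Pole j, 0 ≤ u j x) :
    (∀ i, ∀ x ∉ Pole i, 0 < u i x) ∨
      (⋃ i, Pole i) = ∅ ∧ (∀ i x, f i x = 0) ∧ ∀ i x, u i x = 0 := by
  set α : Set (Fin n) := {i | Pole i = ∅ ∧ ∀ x, u i x = 0} with hα
  have hβ : ∀ j ∈ αᶜ, ∀ x ∉ Pole j, 0 < u j x := fun j hj =>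
    (h.pos_or_eq_zero hd hX hnn j).resolve_right hj
  have hL : ∀ i ∈ α, ∀ x ∉ ⋃ i, Pole i, ∑ j, c i j x * u j x = f i x := by
    intro i hi x hx
    have h1 := h.eqn x hx i
    have h2 : u i = fun _ => 0 := funext hi.2
    have h3 : driftLaplacian g X (u i) x = 0 := by rw [h2, driftLaplacian_const]
    linarith
  rcases α.eq_empty_or_nonempty with hαe | hαne
  · exact Or.inl fun i => hβ i (by simp [hαe])
  rcases (αᶜ).eq_empty_or_nonempty with hβe | hβne
  · right
    have hall : ∀ i, i ∈ α := fun i => by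
      by_contra hi
      exact (hβe ▸ hi : i ∈ (∅ : Set (Fin n)))
    have hP : (⋃ i, Pole i) = ∅ := iUnion_eq_empty.2 fun i => (hall i).1
    refine ⟨hP, fun i x => ?_, fun i x => (hall i).2 x⟩
    rw [← hL i (hall i) x (by simp [hP])]
    exact Finset.sum_eq_zero fun j _ => by rw [(hall j).2 x, mul_zero]
  · exfalso
    refine hfull ⟨α, αᶜ, hαne, hβne, disjoint_compl_right, union_compl_self α, ?_⟩
    intro i hi j hj x hx
    have hxj : ∀ j, x ∉ Pole j := fun j hj => hx (mem_iUnion.2 ⟨j, hj⟩)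
    have hterm : ∀ k ∈ Finset.univ, 0 ≤ c i k x * u k x := by
      intro k _
      by_cases hk : k ∈ α
      · rw [hk.2 x, mul_zero]
      · exact mul_nonneg (h.coop x hx i k (by rintro rfl; exact hk hi)) (hnn k x (hxj k))
    have hsum : ∑ k, c i k x * u k x = 0 :=
      le_antisymm ((hL i hi x hx).trans_le (h.nonpos x hx i)) (Finset.sum_nonneg hterm)
    have := (Finset.sum_eq_zero_iff_of_nonneg hterm).1 hsum j (Finset.mem_univ j)
    exact (mul_eq_zero.1 this).resolve_right (hβ j hj x (hxj j)).ne'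

-- The sum over the components that are negative everywhere is the constant `m`, so `L` annihilates
-- it. The equality case of the algebra then decouples these components from the rest, and full
-- coupling leaves no rest.
open Classical in
theorem neg_of_sum_truncation_neg [T2Space M] [ConnectedSpace M]
    (h : IsCooperativeSystem g X Pole u c f C) (hd : 1 ≤ d)
    (hX : Continuous fun x => (⟨x, X x⟩ : TangentBundle (𝓡 d) M))
    (hfull : FullyCoupled c (⋃ i, Pole i)ᶜ) {m : ℝ}
    (hm : ∀ x, ∑ j, truncation (Pole j) 0 (u j) x = m) (hm0 : m < 0) :
    (⋃ i, Pole i) = ∅ ∧ (∀ i x, f i x = 0) ∧ ∀ x, ∑ i, u i x < 0 := by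
  set S : Finset (Fin n) :=
    Finset.univ.filter fun i => ∀ x, truncation (Pole i) 0 (u i) x < 0 with hSdef
  have hS : ∀ i ∈ S, ∀ x, truncation (Pole i) 0 (u i) x < 0 := fun i hi =>
    (Finset.mem_filter.1 hi).2
  have hS' : ∀ i ∉ S, ∀ x, truncation (Pole i) 0 (u i) x = 0 := fun i hi =>
    (h.truncation_eq_zero_or_neg hd hX hm i).resolve_right fun hneg =>
      hi (Finset.mem_filter.2 ⟨Finset.mem_univ i, hneg⟩)
  have hSP : ∀ i ∈ S, ∀ x, x ∉ Pole i := fun i hi x hx => by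
    have := hS i hi x
    rw [truncation_of_mem hx] at this
    exact lt_irrefl _ this
  have hSu : ∀ i ∈ S, ∀ x, truncation (Pole i) 0 (u i) x = u i x ∧ u i x < 0 := by
    intro i hi x
    have h1 := hS i hi x
    rw [truncation_of_notMem (hSP i hi x)] at h1 ⊢
    have h2 : u i x < 0 := (min_lt_iff.1 h1).resolve_right (lt_irrefl _)
    exact ⟨min_eq_left h2.le, h2⟩
  have hsum : ∀ x, ∑ i ∈ S, u i x = m := fun x => by
    rw [← hm x, ← Finset.sum_subset (Finset.subset_univ S) fun i _ hi => hS' i hi x]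
    exact Finset.sum_congr rfl fun i hi => (hSu i hi x).1.symm
  have hzero : ∀ x ∉ ⋃ i, Pole i,
      (∀ i ∈ S, f i x = 0) ∧ ∀ i ∉ S, ∀ j ∈ S, c i j x = 0 := by
    intro x hx
    have hxj : ∀ j, x ∉ Pole j := fun j hj => hx (mem_iUnion.2 ⟨j, hj⟩)
    refine eq_zero_of_sum_sub_sum_mul_eq_zero (u := fun j => u j x) (h.coop x hx) (h.col x hx)
      (h.nonpos x hx) S (fun j hj => (hSu j hj x).2) (fun j hj => ?_) ?_
    · have := hS' j hj x
      rw [truncation_of_notMem (hxj j)] at this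
      exact min_eq_right_iff.1 this
    · have h1 := driftLaplacian_sum g X S fun j _ => h.contMDiffAt j x (hxj j)
      have h2 : (fun z => ∑ i ∈ S, u i z) = fun _ => m := funext hsum
      rw [h2, driftLaplacian_const] at h1
      simp only [h.eqn x hx] at h1
      exact h1.symm
  obtain ⟨x₁⟩ : Nonempty M := inferInstance
  have hSne : S.Nonempty := by
    rw [Finset.nonempty_iff_ne_empty]
    intro hSe
    have := hsum x₁
    rw [hSe, Finset.sum_empty] at this
    exact hm0.ne this.symm
  have hall : ∀ i, i ∈ S := by
    by_contra! hcon
    obtain ⟨i, hi⟩ := hcon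
    refine hfull ⟨(S : Set (Fin n))ᶜ, S, ⟨i, hi⟩, hSne, disjoint_compl_left,
      compl_union_self _, ?_⟩
    intro i hi j hj x hx
    exact (hzero x hx).2 i hi j hj
  have hP : (⋃ i, Pole i) = ∅ := by
    rw [iUnion_eq_empty]
    exact fun i => eq_empty_of_forall_notMem (hSP i (hall i))
  refine ⟨hP, fun i x => (hzero x (by simp [hP])).1 i (hall i), fun x => ?_⟩
  have hSuniv : S = Finset.univ := Finset.eq_univ_iff_forall.2 hall
  rw [← hSuniv, hsum x]
  exact hm0

theorem trichotomy [T2Space M] [CompactSpace M] [ConnectedSpace M]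
    (h : IsCooperativeSystem g X Pole u c f C) (hd : 1 ≤ d)
    (hX : Continuous fun x => (⟨x, X x⟩ : TangentBundle (𝓡 d) M))
    (hfull : FullyCoupled c (⋃ i, Pole i)ᶜ) :
    (∀ i, ∀ x ∉ Pole i, 0 < u i x) ∨ (⋃ i, Pole i) = ∅ ∧ (∀ i x, f i x = 0) ∧
      ((∀ i x, u i x = 0) ∨ ∀ x, ∑ i, u i x < 0) := by
  obtain ⟨m, hm⟩ := h.exists_sum_truncation_eq hd hX
  obtain ⟨x₁⟩ : Nonempty M := inferInstance
  have hm0 : m ≤ 0 := hm x₁ ▸ Finset.sum_nonpos fun j _ => truncation_le _ _ _ _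
  rcases hm0.lt_or_eq with hlt | rfl
  · obtain ⟨h1, h2, h3⟩ := h.neg_of_sum_truncation_neg hd hX hfull hm hlt
    exact Or.inr ⟨h1, h2, Or.inr h3⟩
  · have hnn : ∀ j, ∀ x ∉ Pole j, 0 ≤ u j x := by
      intro j x hx
      have := (Finset.sum_eq_zero_iff_of_nonpos fun j _ => truncation_le (Pole j) 0 (u j) x).1
        (hm x) j (Finset.mem_univ j)
      rw [truncation_of_notMem hx] at this
      exact min_eq_right_iff.1 this
    rcases h.pos_or_eq_zero_of_nonneg hd hX hfull hnn with h1 | ⟨h1, h2, h3⟩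
    · exact Or.inl h1
    · exact Or.inr ⟨h1, h2, Or.inl h3⟩

end IsCooperativeSystem

end System
end

/-! ### Assembly. -/

theorem mainTheorem1 {d : ℕ} (hd : 1 ≤ d)
    {M : Type*} [TopologicalSpace M] [T2Space M] [CompactSpace M] [ConnectedSpace M]
    [ChartedSpace (EuclideanSpace ℝ (Fin d)) M] [IsManifold (𝓡 d) ∞ M]
    (g : SmoothMetric d M) {n : ℕ}
    (Pole : Fin n → Set M) (hPole : ∀ i, IsDiscrete (Pole i))
    (P : Set M) (hP : P = ⋃ i, Pole i)
    (u : Fin n → M → ℝ)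
    (hu : ∀ i, ContMDiffOn (𝓡 d) 𝓘(ℝ, ℝ) 2 (u i) (Pole i)ᶜ)
    (hu_pole : ∀ i, ∀ p ∈ Pole i, Tendsto (u i) (𝓝[(Pole i)ᶜ] p) atTop)
    (c : Fin n → Fin n → M → ℝ)
    (hc_cont : ∀ i j, ContinuousOn (c i j) Pᶜ)
    (hc_bdd : ∀ i j, ∃ C : ℝ, ∀ x ∈ Pᶜ, |c i j x| ≤ C)
    (hc_coop : ∀ i j, i ≠ j → ∀ x ∈ Pᶜ, 0 ≤ c i j x)
    (hc_col : ∀ j, ∀ x ∈ Pᶜ, ∑ i, c i j x ≤ 0)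
    (hc_full : FullyCoupled c Pᶜ)
    (f : Fin n → M → ℝ)
    (hf_cont : ∀ i, ContinuousOn (f i) Pᶜ)
    (hf_nonpos : ∀ i, ∀ x ∈ Pᶜ, f i x ≤ 0)
    (X : ∀ x : M, TangentSpace (𝓡 d) x)
    (hX : Continuous fun x => (⟨x, X x⟩ : TangentBundle (𝓡 d) M))
    (heq : ∀ i, ∀ x ∈ Pᶜ,
      g.laplacian (u i) x + g.inner x (X x) (g.gradient (u i) x) + ∑ j, c i j x * u j x = f i x) :
    ((∃ i, ∃ x ∈ Pᶜ, f i x ≠ 0) → ∀ i, ∀ x ∈ (Pole i)ᶜ, 0 < u i x) ∧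
    (P.Nonempty → ∀ i, ∀ x ∈ (Pole i)ᶜ, 0 < u i x) ∧
    ((∀ x ∈ Pᶜ, 0 ≤ ∑ i, u i x) →
      (∀ i, ∀ x ∈ (Pole i)ᶜ, 0 < u i x) ∨ (∀ i, ∀ x ∈ (Pole i)ᶜ, u i x = 0)) := by
  subst hP
  have hclosed : ∀ i, IsClosed (Pole i) := fun i =>
    isClosed_of_isDiscrete_of_tendsto_atTop (fun x => neBot_nhdsNE_of_chartedSpace hd x) (hPole i)
      (hu i).continuousOn (hu_pole i)
  choose B hB using hc_bdd
  -- The sum of all the absolute values serves as one nonnegative bound common to all the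
  -- coefficients.
  have hBle : ∀ i j, B i j ≤ ∑ i, ∑ j, |B i j| := fun i j =>
    (le_abs_self _).trans ((Finset.single_le_sum (f := fun j => |B i j|)
      (fun j _ => abs_nonneg _) (Finset.mem_univ j)).trans
      (Finset.single_le_sum (f := fun i => ∑ j, |B i j|)
        (fun i _ => Finset.sum_nonneg fun j _ => abs_nonneg _) (Finset.mem_univ i)))
  have hsys : IsCooperativeSystem g X Pole u c f (∑ i, ∑ j, |B i j|) :=
    -- Being discrete and closed in a compact space, each pole set is finite.
    { finite_pole := fun i => (hclosed i).isCompact.finite (hPole i)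
      contMDiffAt := fun i x hx => (hu i).contMDiffAt ((hclosed i).isOpen_compl.mem_nhds hx)
      tendsto_pole := hu_pole
      bound_nonneg := Finset.sum_nonneg fun i _ => Finset.sum_nonneg fun j _ => abs_nonneg _
      bound := fun x hx i j => (hB i j x hx).trans (hBle i j)
      coop := fun x hx i j hij => hc_coop i j hij x hx
      col := fun x hx j => hc_col j x hx
      nonpos := fun x hx i => hf_nonpos i x hx
      eqn := fun x hx i => by
        have := heq i x hx
        rw [driftLaplacian]
        linarith }
  obtain ⟨x₁⟩ : Nonempty M := inferInstance
  rcases hsys.trichotomy hd hX hc_full with hpos | ⟨hempty, hf0, h0⟩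
  · exact ⟨fun _ => hpos, fun _ => hpos, fun _ => Or.inl hpos⟩
  -- Without positivity there are no poles and `f` vanishes, which contradicts the premises of the
  -- first two claims. In the third, a nonnegative sum rules out the case where it is negative
  -- everywhere.
  · refine ⟨fun ⟨i, x, _, hne⟩ => absurd (hf0 i x) hne,
      fun hne => absurd hempty hne.ne_empty, fun hsum => Or.inr ?_⟩
    rcases h0 with h0 | h0
    · exact fun i x _ => h0 i x
    · exact absurd (hsum x₁ (by simp [hempty])) (not_le.2 (h0 x₁))
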